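/- Theorem (Bound on estimation error). Let $D\in\mathbb N$, $\varepsilon>0$, and let $p_0,p_1$ be Borel probability measures on $\mathbb R^D$ with compact supports $X_0=\operatorname{supp}p_0$ and $X_1=\operatorname{supp}p_1$. For $f,\xi:\mathbb R^D\to\mathbb R$ put $$\mathcal L(f,\xi)=c+\mathbb E_{x\sim p_1}f(x)-\varepsilon\,\mathbb E_{x\sim p_0}\xi(x)-\varepsilon\,\mathbb E_{x\sim p_0}\mathbb E_{z\sim\mathcal N(0,I)}\exp\Big(\tfrac{f(x+\sqrt\varepsilon z)}{\varepsilon}-\xi(x)\Big),\qquad c=\varepsilon\big(1-\tfrac D2\log(2\pi\varepsilon)\big).$$ Let $x_1,\dots,x_N\sim p_0$, $y_1,\dots,y_M\sim p_1$ and $z_{ik}\sim\mathcal N(0,I)$ ($1\le i\le N$, $1\le k\le K$) be jointly independent, with $N,M,K\ge1$, and put $$\widehat{\mathcal L}(f,\xi)=c+\frac1M\sum_{j=1}^M f(y_j)-\frac{\varepsilon}{N}\sum_{i=1}^N\xi(x_i)-\frac{\varepsilon}{NK}\sum_{i=1}^N\sum_{k=1}^K\exp\Big(\tfrac{f(x_i+\sqrt\varepsilon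 z_{ik})}{\varepsilon}-\xi(x_i)\Big).$$ Let $\widetilde{\mathcal L}(f,\xi)$ be the same expression with the average over $k$ replaced by the exact expectation over $z\sim\mathcal N(0,I)$. Let $\Xi$ be a set of functions $\mathbb R^D\to\mathbb R$ that are $L_\xi$-Lipschitz on $X_0$ and bounded there by $M_\xi$ in absolute value, and let $\mathcal F$ be a set of functions $\mathbb R^D\to\mathbb R$. Then there are constants $C_0,C_1$, depending only on $D,\varepsilon,L_f,L_\xi,M_f,M_\xi$ and on upper bounds for the diameters of $X_0$ and $X_1$ (in particular not on $N,M,K$), such that the following hold. (1) If every $f\in\mathcal F$ is $L_f$-Lipschitz on $\mathbb R^D$ with $|f|\le M_f$, then for all $N,M,K\ge1$ $$\mathbb E\sup_{f\in\mathcal F,\ \xi\in\Xi}\big|\mathcal L(f,\xi)-\widehat{\mathcal L}(f,\xi)\big|\le C_0N^{-\frac1{1+D}}+C_1M^{-\frac1{1+D}} .$$ (2) If every $f\in\mathcal F$ is measurable with $|f|\le M_f$ on $\mathbb R^D$ and is $L_f$-Lipschitz on $X_1$, then for all $N,M\ge1$ the same bound holds for $\mathbb E\sup_{f\in\mathcal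 F,\ \xi\in\Xi}|\mathcal L(f,\xi)-\widetilde{\mathcal L}(f,\xi)|$. In both parts the supremum is an (almost everywhere) measurable function of the sample; the supremum over an empty family is $0$. -/

import Mathlib

open MeasureTheory ProbabilityTheory
open scoped NNReal ENNReal

namespace VarEOT

/-- The class of real functions whose restriction to `S` is `L`-Lipschitz and bounded by `M` in
absolute value. -/
def LipBdd {D : ℕ} (L : ℝ≥0) (M : ℝ) (S : Set (EuclideanSpace ℝ (Fin D))) :
    Set (EuclideanSpace ℝ (Fin D) → ℝ) :=
  {g | LipschitzOnWith L g S ∧ ∀ x ∈ S, |g x| ≤ M}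

/-- The additive constant `ε (1 - (D/2) log (2πε))` of the loss. -/
noncomputable def lossConst (D : ℕ) (ε : ℝ) : ℝ :=
  ε * (1 - (D : ℝ) / 2 * Real.log (2 * Real.pi * ε))

/-- The inner expectation `E_{z ∼ N(0,I)} exp (f (x + √ε z) / ε - ξ x)`, which equals
`(2πε)^(-D/2) Z(f, x) / exp (ξ x)` for the partition function `Z(f, x)`. -/
noncomputable def expTerm {D : ℕ} (ε : ℝ) (f ξ : EuclideanSpace ℝ (Fin D) → ℝ)
    (x : EuclideanSpace ℝ (Fin D)) : ℝ :=
  ∫ z, Real.exp (f (x + √ε • z) / ε - ξ x) ∂(stdGaussian (EuclideanSpace ℝ (Fin D)))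

/-- The population loss `L(f, ξ)`. -/
noncomputable def loss {D : ℕ} (ε : ℝ) (p₀ p₁ : Measure (EuclideanSpace ℝ (Fin D)))
    (f ξ : EuclideanSpace ℝ (Fin D) → ℝ) : ℝ :=
  lossConst D ε + (∫ y, f y ∂p₁) - ε * (∫ x, ξ x ∂p₀) - ε * ∫ x, expTerm ε f ξ x ∂p₀

/-- The empirical loss on data `x₁, …, x_N` and `y₁, …, y_M` with `K` Gaussian noise variables
`z i 1, …, z i K` for each `x i`. It carries the same additive constant as `loss`. -/
noncomputable def empLoss {D : ℕ} (ε : ℝ) {N M K : ℕ}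
    (x : Fin N → EuclideanSpace ℝ (Fin D)) (y : Fin M → EuclideanSpace ℝ (Fin D))
    (z : Fin N → Fin K → EuclideanSpace ℝ (Fin D))
    (f ξ : EuclideanSpace ℝ (Fin D) → ℝ) : ℝ :=
  lossConst D ε + (1 / (M : ℝ)) * ∑ j, f (y j) - ε * ((1 / (N : ℝ)) * ∑ i, ξ (x i))
    - ε / ((N : ℝ) * (K : ℝ)) * ∑ i, ∑ k, Real.exp (f (x i + √ε • z i k) / ε - ξ (x i))

/-- The empirical loss in which the inner Gaussian expectation (the partition function) is
evaluated exactly at each data point. It carries the same additive constant as `loss`. -/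
noncomputable def empLossExact {D : ℕ} (ε : ℝ) {N M : ℕ}
    (x : Fin N → EuclideanSpace ℝ (Fin D)) (y : Fin M → EuclideanSpace ℝ (Fin D))
    (f ξ : EuclideanSpace ℝ (Fin D) → ℝ) : ℝ :=
  lossConst D ε + (1 / (M : ℝ)) * ∑ j, f (y j) - ε * ((1 / (N : ℝ)) * ∑ i, ξ (x i))
    - ε / (N : ℝ) * ∑ i, expTerm ε f ξ (x i)

/-- The law of two independent i.i.d. data sets, of size `N` from `p₀` and of size `M` from `p₁`. -/
noncomputable def dataLaw {D : ℕ} (p₀ p₁ : Measure (EuclideanSpace ℝ (Fin D))) (N M : ℕ) :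
    Measure ((Fin N → EuclideanSpace ℝ (Fin D)) × (Fin M → EuclideanSpace ℝ (Fin D))) :=
  (Measure.pi fun _ => p₀).prod (Measure.pi fun _ => p₁)

/-- The law of an `N × K` array of i.i.d. standard Gaussian vectors. -/
noncomputable def noiseLaw (D N K : ℕ) :
    Measure (Fin N → Fin K → EuclideanSpace ℝ (Fin D)) :=
  Measure.pi fun _ => Measure.pi fun _ => stdGaussian (EuclideanSpace ℝ (Fin D))

/-- The uniform deviation `sup_{f ∈ F, ξ ∈ Ξ} |L(f, ξ) - L̂(f, ξ)|` of the empirical loss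
`L̂ = empLoss`, with value in `[0, ∞]`, as a function of the data and the noise. -/
noncomputable def supDev {D : ℕ} (ε : ℝ) (p₀ p₁ : Measure (EuclideanSpace ℝ (Fin D)))
    (F Ξ : Set (EuclideanSpace ℝ (Fin D) → ℝ)) (N M K : ℕ)
    (s : ((Fin N → EuclideanSpace ℝ (Fin D)) × (Fin M → EuclideanSpace ℝ (Fin D))) ×
      (Fin N → Fin K → EuclideanSpace ℝ (Fin D))) : ℝ≥0∞ :=
  ⨆ f ∈ F, ⨆ ξ ∈ Ξ, ENNReal.ofReal |loss ε p₀ p₁ f ξ - empLoss ε s.1.1 s.1.2 s.2 f ξ|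

/-- The uniform deviation of the empirical loss `empLossExact`, as a function of the data. -/
noncomputable def supDevExact {D : ℕ} (ε : ℝ) (p₀ p₁ : Measure (EuclideanSpace ℝ (Fin D)))
    (F Ξ : Set (EuclideanSpace ℝ (Fin D) → ℝ)) (N M : ℕ)
    (s : (Fin N → EuclideanSpace ℝ (Fin D)) × (Fin M → EuclideanSpace ℝ (Fin D))) : ℝ≥0∞ :=
  ⨆ f ∈ F, ⨆ ξ ∈ Ξ, ENNReal.ofReal |loss ε p₀ p₁ f ξ - empLossExact ε s.1 s.2 f ξ|

end VarEOT

namespace VarEOT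

/-! The constants cancel in the difference of the two losses. What remains is the deviation of `f`
on the `p₁`-sample, that of `ξ` on the `p₀`-sample, and that of the exponential term. In part (1)
the exponential term is the mean over `k` of the deviations of `exp (-ξ x) * exp (f (x + √ε z) / ε)`
on the i.i.d. pairs `(x i, z i k)`. Each has the same expected bound, so `K` drops out even though
different `k` share the `x i`. In part (2) it is the deviation of `exp (-ξ)` times a Gaussian
smoothing, which is Lipschitz by Cameron–Martin even when `f` is only bounded and measurable.

Everything thus reduces to `exists_lipschitz_mul_deviation_bound`: a uniform law of large numbers
for products `a (X) * b (W)` of bounded Lipschitz functions. The pair `(X, W)` lives in dimension `2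
* D`, yet the rate must be that of dimension `D`. This is possible because `a` and `b` are
approximated separately by step functions on dyadic cells. The deviation of a product of step
functions is a bilinear form in their values, so it is dominated by its values at pairs of sign
vectors (`exists_bilinear_bound`). The logarithm of the number of such pairs is of the order of the
sum, not the product, of the two numbers of cells.

A Bernstein-type maximal inequality (`exists_maximal_bound`) controls each dyadic level, and
chaining up to cell side about `n ^ (-1 / (1 + D))` gives a convergent geometric sum
(`exists_unitCube_bound`). Since `W` may be unbounded, this is done on each pair of unit cubes. The
variance-sensitive bound leaves a factor `√p`, with `p` the probability of the pair of cubes, and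
these factors are summable by an exponential moment.

Every bound is stated through a measurable envelope `H` that dominates all members of a class at
once, so suprema need not be measurable along the way. -/

/-- The centered sum `∑ i, (φ (s i) - ∫ φ dμ)` of a function over a sample. -/
noncomputable def centeredSum {Ω : Type*} [MeasurableSpace Ω] (μ : Measure Ω) {n : ℕ}
    (φ : Ω → ℝ) (s : Fin n → Ω) : ℝ :=
  ∑ i, (φ (s i) - ∫ ω, φ ω ∂μ)

/-! ### Exponential moments and maximal inequalities for finite families -/

section CenteredSum

variable {Ω : Type*} [MeasurableSpace Ω] {μ : Measure Ω} {n : ℕ}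

lemma centeredSum_add {φ ψ : Ω → ℝ} (hφ : Integrable φ μ) (hψ : Integrable ψ μ)
    (s : Fin n → Ω) :
    centeredSum μ (fun ω => φ ω + ψ ω) s = centeredSum μ φ s + centeredSum μ ψ s := by
  simp only [centeredSum, integral_add hφ hψ, ← Finset.sum_add_distrib]
  exact Finset.sum_congr rfl fun i _ => by ring

lemma centeredSum_const_mul (c : ℝ) (φ : Ω → ℝ) (s : Fin n → Ω) :
    centeredSum μ (fun ω => c * φ ω) s = c * centeredSum μ φ s := by
  simp only [centeredSum, integral_const_mul, Finset.mul_sum]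
  exact Finset.sum_congr rfl fun i _ => by ring

lemma centeredSum_finset_sum {ι : Type*} (t : Finset ι) {φ : ι → Ω → ℝ}
    (hφ : ∀ i ∈ t, Integrable (φ i) μ) (s : Fin n → Ω) :
    centeredSum μ (fun ω => ∑ i ∈ t, φ i ω) s = ∑ i ∈ t, centeredSum μ (φ i) s := by
  simp only [centeredSum, integral_finsetSum t hφ]
  rw [Finset.sum_comm]
  exact Finset.sum_congr rfl fun i _ => by rw [Finset.sum_sub_distrib]

lemma measurable_centeredSum {φ : Ω → ℝ} (hφ : Measurable φ) :
    Measurable (centeredSum (n := n) μ φ) := by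
  unfold centeredSum
  fun_prop

lemma abs_centeredSum_le [IsProbabilityMeasure μ] {φ : Ω → ℝ} {c : ℝ} (hφ : ∀ ω, |φ ω| ≤ c)
    (s : Fin n → Ω) : |centeredSum μ φ s| ≤ n * (2 * c) := by
  have hm : |∫ ω, φ ω ∂μ| ≤ c := by
    have := norm_integral_le_of_norm_le_const (μ := μ) (f := φ) (C := c) (ae_of_all _ hφ)
    simpa using this
  calc |centeredSum μ φ s| ≤ ∑ i, |φ (s i) - ∫ ω, φ ω ∂μ| := Finset.abs_sum_le_sum_abs _ _
    _ ≤ ∑ _i : Fin n, (2 * c) := Finset.sum_le_sum fun i _ => by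
        have := abs_sub (φ (s i)) (∫ ω, φ ω ∂μ)
        have := hφ (s i)
        linarith
    _ = n * (2 * c) := by simp

variable [IsProbabilityMeasure μ]

lemma integrable_of_abs_le {φ : Ω → ℝ} (hφ : Measurable φ) {c : ℝ} (h : ∀ ω, |φ ω| ≤ c) :
    Integrable φ μ :=
  Integrable.of_bound hφ.aestronglyMeasurable c (ae_of_all _ h)

/-- Integrating `exp y ≤ 1 + y + y ^ 2`, valid for `|y| ≤ 1`, gives `1 + t ^ 2 * Var φ`. Keeping the
second moment `p`, rather than the sup bound as Hoeffding would, is what later produces the factor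
`√p` on a cube of probability `p`. -/
lemma integral_exp_centered_le {φ : Ω → ℝ} (hφ : Measurable φ) (h1 : ∀ ω, |φ ω| ≤ 1)
    {p t : ℝ} (hp : ∫ ω, φ ω ^ 2 ∂μ ≤ p) (ht0 : 0 ≤ t) (ht : t ≤ 1 / 2) :
    ∫ ω, Real.exp (t * (φ ω - ∫ ω', φ ω' ∂μ)) ∂μ ≤ Real.exp (t ^ 2 * p) := by
  set m := ∫ ω', φ ω' ∂μ with hm
  have hm1 : |m| ≤ 1 := by
    have := norm_integral_le_of_norm_le_const (μ := μ) (f := φ) (C := 1) (ae_of_all _ h1)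
    simpa using this
  have hi : Integrable φ μ := integrable_of_abs_le hφ h1
  have hi2 : Integrable (fun ω => φ ω ^ 2) μ :=
    integrable_of_abs_le (hφ.pow_const 2) (c := 1) fun ω => by
      rw [abs_pow]; exact pow_le_one₀ (abs_nonneg _) (h1 ω)
  have hb : ∀ ω, |t * (φ ω - m)| ≤ 1 := fun ω => by
    rw [abs_mul, abs_of_nonneg ht0]
    have := abs_sub (φ ω) m
    have := h1 ω
    nlinarith [abs_nonneg (φ ω - m)]
  have hlin : Integrable (fun ω => (1 - t * m + t ^ 2 * m ^ 2) + (t - 2 * t ^ 2 * m) * φ ω) μ :=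
    (integrable_const _).add (hi.const_mul _)
  have key : ∀ ω, Real.exp (t * (φ ω - m)) ≤
      (1 - t * m + t ^ 2 * m ^ 2) + (t - 2 * t ^ 2 * m) * φ ω + t ^ 2 * φ ω ^ 2 := fun ω => by
    have h := Real.abs_exp_sub_one_sub_id_le (hb ω)
    have := (abs_le.1 h).2
    nlinarith
  calc ∫ ω, Real.exp (t * (φ ω - m)) ∂μ
      ≤ ∫ ω, ((1 - t * m + t ^ 2 * m ^ 2) + (t - 2 * t ^ 2 * m) * φ ω + t ^ 2 * φ ω ^ 2) ∂μ := by
        refine integral_mono_of_nonneg (ae_of_all _ fun ω => (Real.exp_pos _).le) ?_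
          (ae_of_all _ key)
        exact hlin.add (hi2.const_mul _)
    _ = (1 - t * m + t ^ 2 * m ^ 2) + (t - 2 * t ^ 2 * m) * m + t ^ 2 * ∫ ω, φ ω ^ 2 ∂μ := by
        rw [integral_add hlin (hi2.const_mul _),
          integral_add (integrable_const _) (hi.const_mul _), integral_const_mul,
          integral_const_mul]
        simp [← hm]
    _ ≤ t ^ 2 * p + 1 := by nlinarith [mul_le_mul_of_nonneg_left hp (sq_nonneg t), sq_nonneg (t * m)]
    _ ≤ Real.exp (t ^ 2 * p) := Real.add_one_le_exp _

lemma integral_exp_centeredSum_le {φ : Ω → ℝ} (hφ : Measurable φ) (h1 : ∀ ω, |φ ω| ≤ 1)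
    {p t : ℝ} (hp : ∫ ω, φ ω ^ 2 ∂μ ≤ p) (ht0 : 0 ≤ t) (ht : t ≤ 1 / 2) :
    ∫ s : Fin n → Ω, Real.exp (t * centeredSum μ φ s) ∂(Measure.pi fun _ => μ) ≤
      Real.exp (n * (t ^ 2 * p)) := by
  have : ∀ s : Fin n → Ω, Real.exp (t * centeredSum μ φ s) =
      ∏ i, Real.exp (t * (φ (s i) - ∫ ω', φ ω' ∂μ)) := fun s => by
    rw [centeredSum, Finset.mul_sum, Real.exp_sum]
  simp only [this]
  rw [integral_fintype_prod_eq_pow (fun ω => Real.exp (t * (φ ω - ∫ ω', φ ω' ∂μ))),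
    Fintype.card_fin, Real.exp_nat_mul]
  exact pow_le_pow_left₀ (integral_nonneg fun ω => (Real.exp_pos _).le)
    (integral_exp_centered_le hφ h1 hp ht0 ht) _

/-- Maximal inequality for a finite family of functions, at a fixed exponential scale `t`. -/
lemma exists_maximal_bound_of_scale {J : Type*} [Fintype J] [Nonempty J] {φ : J → Ω → ℝ}
    (hφ : ∀ j, Measurable (φ j)) (h1 : ∀ j ω, |φ j ω| ≤ 1) {p t : ℝ}
    (hp : ∀ j, ∫ ω, φ j ω ^ 2 ∂μ ≤ p) (hp0 : 0 ≤ p) (ht0 : 0 < t) (ht : t ≤ 1 / 2) :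
    ∃ H : (Fin n → Ω) → ℝ≥0∞, Measurable H ∧
      (∀ s j, ENNReal.ofReal (centeredSum μ (φ j) s) ≤ H s) ∧
      ∫⁻ s, H s ∂(Measure.pi fun _ => μ) ≤
        ENNReal.ofReal ((1 + Real.log (Fintype.card J)) / t + n * t * p) := by
  set c : ℝ := Fintype.card J * Real.exp (n * (t ^ 2 * p)) with hc
  have hcard : (1 : ℝ) ≤ Fintype.card J := by exact_mod_cast Fintype.card_pos
  have hexp1 : 1 ≤ Real.exp (n * (t ^ 2 * p)) := Real.one_le_exp (by positivity)
  have hc1 : 1 ≤ c := one_le_mul_of_one_le_of_one_le hcard hexp1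
  have hc0 : 0 < c := by linarith
  have hlogc : Real.log c = Real.log (Fintype.card J) + n * (t ^ 2 * p) := by
    rw [hc, Real.log_mul (by positivity) (by positivity), Real.log_exp]
  have hlog0 : 0 ≤ Real.log c := Real.log_nonneg hc1
  -- Log-sum-exp linearized at `c`: from `log u ≤ u - 1` with `u = exp (t * S) / c`, each centered
  -- sum `S` is at most `h`. Since `c` bounds the expected sum of exponentials, the mean of `h` is
  -- at most `(1 + log c) / t`.
  let h : (Fin n → Ω) → ℝ := fun s =>
    ((∑ j, Real.exp (t * centeredSum μ (φ j) s)) / c + Real.log c) / t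
  have hm : ∀ j, Measurable fun s : Fin n → Ω => Real.exp (t * centeredSum μ (φ j) s) :=
    fun j => ((measurable_centeredSum (hφ j)).const_mul t).exp
  have hi : ∀ j, Integrable (fun s : Fin n → Ω => Real.exp (t * centeredSum μ (φ j) s))
      (Measure.pi fun _ => μ) := fun j =>
    integrable_of_abs_le (hm j) (c := Real.exp (t * (n * (2 * 1)))) fun s => by
      rw [Real.abs_exp]
      exact Real.exp_le_exp.2 (mul_le_mul_of_nonneg_left
        ((le_abs_self _).trans (abs_centeredSum_le (h1 j) s)) ht0.le)
  have hisum := integrable_finsetSum Finset.univ fun j _ => hi j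
  have hmeas : Measurable h := by
    refine Measurable.div_const (Measurable.add_const (Measurable.div_const ?_ _) _) _
    exact Finset.measurable_sum _ fun j _ => hm j
  have hint : Integrable h (Measure.pi fun _ => μ) :=
    ((hisum.div_const c).add (integrable_const _)).div_const t
  have h0 : ∀ s, 0 ≤ h s := fun s => by
    have : 0 ≤ ∑ j, Real.exp (t * centeredSum μ (φ j) s) :=
      Finset.sum_nonneg fun j _ => (Real.exp_pos _).le
    positivity
  refine ⟨fun s => ENNReal.ofReal (h s), hmeas.ennreal_ofReal, fun s j => ?_, ?_⟩
  · refine ENNReal.ofReal_le_ofReal ?_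
    rw [le_div_iff₀ ht0]
    have e1 : Real.exp (t * centeredSum μ (φ j) s) ≤
        ∑ j, Real.exp (t * centeredSum μ (φ j) s) :=
      Finset.single_le_sum (f := fun j => Real.exp (t * centeredSum μ (φ j) s))
        (fun j _ => (Real.exp_pos _).le) (Finset.mem_univ j)
    have e2 := Real.log_le_sub_one_of_pos
      (show 0 < Real.exp (t * centeredSum μ (φ j) s) / c by positivity)
    rw [Real.log_div (by positivity) hc0.ne', Real.log_exp] at e2
    have e3 := div_le_div_of_nonneg_right e1 hc0.le
    linarith
  · rw [← ofReal_integral_eq_lintegral_ofReal hint (ae_of_all _ h0)]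
    refine ENNReal.ofReal_le_ofReal ?_
    have e1 : ∫ s, h s ∂(Measure.pi fun _ : Fin n => μ) =
        ((∑ j, ∫ s, Real.exp (t * centeredSum μ (φ j) s) ∂(Measure.pi fun _ : Fin n => μ)) / c
          + Real.log c) / t := by
      simp only [h]
      rw [integral_div, integral_add (hisum.div_const c) (integrable_const _), integral_div,
        integral_finsetSum _ fun j _ => hi j]
      simp
    have e2 : (∑ j, ∫ s, Real.exp (t * centeredSum μ (φ j) s) ∂(Measure.pi fun _ : Fin n => μ))
        ≤ c := by
      refine (Finset.sum_le_sum fun j _ =>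
        integral_exp_centeredSum_le (hφ j) (h1 j) (hp j) ht0.le ht).trans ?_
      simp [hc]
    rw [e1, hlogc, show n * t * p = n * (t ^ 2 * p) / t by field_simp, ← add_div]
    have := (div_le_one hc0).2 e2
    exact div_le_div_of_nonneg_right (by linarith) ht0.le

/-- Deviation bound for functions dominated by a multiple of the indicator of a set. -/
lemma exists_indicator_bound {A : Set Ω} (hA : MeasurableSet A) :
    ∃ H : (Fin n → Ω) → ℝ≥0∞, Measurable H ∧
      (∀ (φ : Ω → ℝ) (c : ℝ), 0 ≤ c → (∀ ω, |φ ω| ≤ c * A.indicator 1 ω) → ∀ s : Fin n → Ω,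
        ENNReal.ofReal |centeredSum μ φ s| ≤ ENNReal.ofReal c * H s) ∧
      ∫⁻ s, H s ∂(Measure.pi fun _ => μ) ≤ ENNReal.ofReal (2 * (n * μ.real A)) := by
  set p := μ.real A with hp
  have hp0 : 0 ≤ p := measureReal_nonneg
  have hindi : Integrable (A.indicator (1 : Ω → ℝ)) μ :=
    (integrable_const (1 : ℝ)).indicator hA
  have hindp : ∫ ω, A.indicator (1 : Ω → ℝ) ω ∂μ = p := by
    rw [integral_indicator_one hA]
  refine ⟨fun s => ENNReal.ofReal (∑ i, (A.indicator (1 : Ω → ℝ) (s i) + p)), ?_, ?_, ?_⟩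
  · refine Measurable.ennreal_ofReal (Finset.measurable_sum _ fun i _ => ?_)
    exact ((measurable_one.indicator hA).comp (measurable_pi_apply i)).add_const _
  · intro φ c hc h1 s
    rw [← ENNReal.ofReal_mul hc, Finset.mul_sum]
    refine ENNReal.ofReal_le_ofReal ((Finset.abs_sum_le_sum_abs _ _).trans
      (Finset.sum_le_sum fun i _ => ?_))
    have e1 : |∫ ω, φ ω ∂μ| ≤ c * p := by
      rw [← hindp, ← integral_const_mul]
      refine (abs_integral_le_integral_abs).trans ?_
      exact integral_mono_of_nonneg (ae_of_all _ fun ω => abs_nonneg _) (hindi.const_mul _)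
        (ae_of_all _ fun ω => h1 ω)
    have e2 := h1 (s i)
    have e3 := abs_sub (φ (s i)) (∫ ω, φ ω ∂μ)
    linarith
  · have hii : ∀ i : Fin n, Integrable (fun s : Fin n → Ω => A.indicator (1 : Ω → ℝ) (s i))
        (Measure.pi fun _ => μ) := fun i => integrable_comp_eval (μ := fun _ => μ) hindi
    have hia : ∀ i : Fin n, Integrable (fun s : Fin n → Ω => A.indicator (1 : Ω → ℝ) (s i) + p)
        (Measure.pi fun _ => μ) := fun i => (hii i).add (integrable_const _)
    rw [← ofReal_integral_eq_lintegral_ofReal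
      (integrable_finsetSum _ fun i _ => hia i)
      (ae_of_all _ fun s => Finset.sum_nonneg fun i _ =>
        add_nonneg (Set.indicator_nonneg (fun _ _ => zero_le_one) _) hp0)]
    refine ENNReal.ofReal_le_ofReal ?_
    rw [integral_finsetSum _ fun i _ => hia i]
    have : ∀ i : Fin n, ∫ s : Fin n → Ω, (A.indicator (1 : Ω → ℝ) (s i) + p)
        ∂(Measure.pi fun _ => μ) = 2 * p := fun i => by
      rw [integral_add (hii i) (integrable_const _), integral_comp_eval (μ := fun _ => μ)
        hindi.aestronglyMeasurable, hindp]
      simp; ring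
    simp only [this]
    simp
    linarith

/-- Maximal inequality for a finite family of functions dominated by the indicator of a set of
probability `p`. -/
lemma exists_maximal_bound {J : Type*} [Fintype J] [Nonempty J] {φ : J → Ω → ℝ}
    (hφ : ∀ j, Measurable (φ j)) {A : Set Ω} (hA : MeasurableSet A)
    (h1 : ∀ j ω, |φ j ω| ≤ A.indicator 1 ω) {m : ℝ} (hm : 1 + Real.log (Fintype.card J) ≤ m) :
    ∃ H : (Fin n → Ω) → ℝ≥0∞, Measurable H ∧
      (∀ s j, ENNReal.ofReal (centeredSum μ (φ j) s) ≤ H s) ∧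
      ∫⁻ s, H s ∂(Measure.pi fun _ => μ) ≤ ENNReal.ofReal (3 * √(m * (n * μ.real A))) := by
  set p := μ.real A with hp
  have hp0 : 0 ≤ p := measureReal_nonneg
  have hcard : (1 : ℝ) ≤ Fintype.card J := by exact_mod_cast Fintype.card_pos
  have hm1 : 1 ≤ m := by have := Real.log_nonneg hcard; linarith
  have hind1 : ∀ ω, A.indicator (1 : Ω → ℝ) ω ≤ 1 := fun ω =>
    Set.indicator_le_self' (fun _ _ => zero_le_one) ω
  have hindi : Integrable (A.indicator (1 : Ω → ℝ)) μ :=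
    (integrable_const (1 : ℝ)).indicator hA
  have hindp : ∫ ω, A.indicator (1 : Ω → ℝ) ω ∂μ = p := by
    rw [integral_indicator_one hA]
  -- If `n * p < m`, the optimal scale would leave the range `t ≤ 1 / 2`, but then the crude bound
  -- `2 * n * p` is already below `2 * √(m * n * p)`.
  rcases le_or_gt m (n * p) with hmp | hmp
  · have hnp : 0 < n * p := by linarith
    -- Half the minimizer of `m / t + n * t * p`, so that `t ≤ 1 / 2`. The two terms become `2` and
    -- `1 / 2` times `√(m * n * p)`.
    set t : ℝ := √(m / (n * p)) / 2 with ht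
    have ht0 : 0 < t := by positivity
    have ht1 : t ≤ 1 / 2 := by
      have : √(m / (n * p)) ≤ 1 := Real.sqrt_le_one.2 ((div_le_one hnp).2 hmp)
      linarith
    obtain ⟨H, hH, hs, hint⟩ := exists_maximal_bound_of_scale (n := n) hφ
      (fun j ω => (h1 j ω).trans (hind1 ω)) (p := p) (fun j => by
        rw [← hindp]
        refine integral_mono_of_nonneg (ae_of_all _ fun ω => sq_nonneg _) hindi
          (ae_of_all _ fun ω => ?_)
        have e1 := h1 j ω
        have e2 := hind1 ω
        show φ j ω ^ 2 ≤ _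
        rw [← sq_abs]
        nlinarith [abs_nonneg (φ j ω)]) hp0 ht0 ht1
    refine ⟨H, hH, hs, hint.trans (ENNReal.ofReal_le_ofReal ?_)⟩
    have hs0 : 0 < √(m * (n * p)) := by positivity
    have hsq : √(m * (n * p)) * √(m * (n * p)) = m * (n * p) := Real.mul_self_sqrt (by positivity)
    have h2 : t * (2 * (n * p)) = √(m * (n * p)) := by
      have : √(m / (n * p)) = √(m * (n * p)) / (n * p) := by
        rw [show m / (n * p) = m * (n * p) / (n * p) ^ 2 by field_simp,
          Real.sqrt_div' _ (by positivity), Real.sqrt_sq hnp.le]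
      have h3 := div_mul_cancel₀ √(m * (n * p)) hnp.ne'
      rw [ht, this]
      linarith
    have h3 : m / t = 2 * √(m * (n * p)) := by
      rw [div_eq_iff ht0.ne']
      refine mul_right_cancel₀ hnp.ne' ?_
      linear_combination -hsq - √(m * (n * p)) * h2
    have h5 : (1 + Real.log (Fintype.card J)) / t ≤ m / t := by gcongr
    have h6 : n * t * p = √(m * (n * p)) / 2 := by rw [← h2]; ring
    rw [h6]
    linarith
  · obtain ⟨H, hH, hs, hint⟩ := exists_indicator_bound (n := n) (μ := μ) hA
    refine ⟨H, hH, fun s j => ?_, hint.trans (ENNReal.ofReal_le_ofReal ?_)⟩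
    · have := hs (φ j) 1 zero_le_one (by simpa using h1 j) s
      rw [ENNReal.ofReal_one, one_mul] at this
      exact (ENNReal.ofReal_le_ofReal (le_abs_self _)).trans this
    · have hnp0 : 0 ≤ n * p := by positivity
      have : n * p ≤ √(m * (n * p)) := Real.le_sqrt_of_sq_le (by nlinarith)
      linarith

end CenteredSum

/-! ### Bilinear forms on cubes and products of step functions -/

/-- The sign `±1` encoded by a Boolean. -/
def boolSign (b : Bool) : ℝ := if b then 1 else -1

lemma abs_boolSign (b : Bool) : |boolSign b| = 1 := by cases b <;> simp [boolSign]

lemma exists_boolSign_mul_eq_abs (x : ℝ) : ∃ b, boolSign b * x = |x| := by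
  rcases le_total 0 x with h | h
  · exact ⟨true, by simp [boolSign, abs_of_nonneg h]⟩
  · exact ⟨false, by simp [boolSign, abs_of_nonpos h]⟩

/-- Take `t` to be the signs of `c`. The choice depends on `c` alone, hence serves all `α` and `δ`
simultaneously. -/
lemma exists_sum_mul_le_boolSign {U : Type*} [Fintype U] (c : U → ℝ) :
    ∃ t : U → Bool, ∀ (α : U → ℝ) (δ : ℝ), (∀ a, |α a| ≤ δ) →
      |∑ a, α a * c a| ≤ δ * ∑ a, boolSign (t a) * c a := by
  choose t ht using fun a => exists_boolSign_mul_eq_abs (c a)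
  refine ⟨t, fun α δ h => ?_⟩
  rw [Finset.mul_sum]
  refine (Finset.abs_sum_le_sum_abs _ _).trans (Finset.sum_le_sum fun a _ => ?_)
  rw [ht, abs_mul]
  exact mul_le_mul_of_nonneg_right (h a) (abs_nonneg _)

/-- A bilinear form on a product of cubes is dominated by its value at some pair of vertices. -/
lemma exists_bilinear_le_boolSign {U V : Type*} [Fintype U] [Fintype V] (c : U → V → ℝ)
    {α : U → ℝ} {β : V → ℝ} {δ M : ℝ} (hδ : 0 ≤ δ) (hα : ∀ a, |α a| ≤ δ)
    (hβ : ∀ b, |β b| ≤ M) :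
    ∃ (s : U → Bool) (t : V → Bool),
      |∑ a, ∑ b, α a * β b * c a b| ≤
        δ * M * ∑ a, ∑ b, boolSign (s a) * boolSign (t b) * c a b := by
  -- Optimize one variable at a time: the form is linear in `α` for fixed `β`, and then linear in
  -- `β` once the signs `s` are fixed.
  obtain ⟨s, hs⟩ := exists_sum_mul_le_boolSign fun a => ∑ b, β b * c a b
  obtain ⟨t, ht⟩ := exists_sum_mul_le_boolSign fun b => ∑ a, boolSign (s a) * c a b
  refine ⟨s, t, ?_⟩
  have e1 : ∀ (x : U → ℝ) (y : V → ℝ),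
      ∑ a, ∑ b, x a * y b * c a b = ∑ a, x a * ∑ b, y b * c a b := fun x y => by
    simp only [Finset.mul_sum, mul_assoc]
  have e2 : ∀ (x : U → ℝ) (y : V → ℝ),
      ∑ a, x a * ∑ b, y b * c a b = ∑ b, y b * ∑ a, x a * c a b := fun x y => by
    simp only [Finset.mul_sum]
    rw [Finset.sum_comm]
    exact Finset.sum_congr rfl fun b _ => Finset.sum_congr rfl fun a _ => by ring
  rw [e1, e1, mul_assoc]
  refine (hs α δ hα).trans (mul_le_mul_of_nonneg_left ?_ hδ)
  rw [e2, e2]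
  exact (le_abs_self _).trans (ht β M hβ)

/-- Uniform deviation bound for products of two step functions on a set `A`. -/
lemma exists_bilinear_bound {Ω U V : Type*} [MeasurableSpace Ω] {μ : Measure Ω} {n : ℕ}
    [IsProbabilityMeasure μ] [Fintype U] [Fintype V] [MeasurableSpace U]
    [DiscreteMeasurableSpace U] [MeasurableSpace V] [DiscreteMeasurableSpace V]
    {u : Ω → U} {v : Ω → V} (hu : Measurable u) (hv : Measurable v) {A : Set Ω}
    (hA : MeasurableSet A) :
    ∃ H : (Fin n → Ω) → ℝ≥0∞, Measurable H ∧
      (∀ (α : U → ℝ) (β : V → ℝ) (δ M : ℝ), 0 ≤ δ → 0 ≤ M → (∀ a, |α a| ≤ δ) →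
        (∀ b, |β b| ≤ M) → ∀ s : Fin n → Ω,
        ENNReal.ofReal |centeredSum μ (A.indicator fun ω => α (u ω) * β (v ω)) s| ≤
          ENNReal.ofReal (δ * M) * H s) ∧
      ∫⁻ s, H s ∂(Measure.pi fun _ => μ) ≤
        ENNReal.ofReal (3 * √((1 + Fintype.card U + Fintype.card V) * (n * μ.real A))) := by
  classical
  -- The finite family consists of pairs of sign patterns, `2 ^ |U| * 2 ^ |V|` in number, so its
  -- log-cardinality is additive in `|U|` and `|V|`.
  let φ : (U → Bool) × (V → Bool) → Ω → ℝ := fun j =>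
    A.indicator fun ω => boolSign (j.1 (u ω)) * boolSign (j.2 (v ω))
  have hmeas : ∀ (α : U → ℝ) (β : V → ℝ),
      Measurable (A.indicator fun ω => α (u ω) * β (v ω)) := fun α β =>
    Measurable.indicator ((Measurable.of_discrete.comp hu).mul (Measurable.of_discrete.comp hv)) hA
  have hcard : 1 + Real.log (Fintype.card ((U → Bool) × (V → Bool))) ≤
      1 + Fintype.card U + Fintype.card V := by
    have : Real.log 2 ≤ 1 := by have := Real.log_two_lt_d9; linarith
    simp only [Fintype.card_prod, Fintype.card_fun, Fintype.card_bool, Nat.cast_mul, Nat.cast_pow,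
      Nat.cast_ofNat]
    rw [Real.log_mul (by positivity) (by positivity), Real.log_pow, Real.log_pow]
    have h1 := mul_le_mul_of_nonneg_left this (Nat.cast_nonneg (α := ℝ) (Fintype.card U))
    have h2 := mul_le_mul_of_nonneg_left this (Nat.cast_nonneg (α := ℝ) (Fintype.card V))
    linarith
  obtain ⟨H, hH, hs, hint⟩ := exists_maximal_bound (n := n) (μ := μ) (φ := φ)
    (fun j => hmeas (fun a => boolSign (j.1 a)) fun b => boolSign (j.2 b)) hA (fun j ω => by
      by_cases h : ω ∈ A <;> simp [φ, h, abs_mul, abs_boolSign]) hcard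
  refine ⟨H, hH, fun α β δ M hδ hM hα hβ s => ?_, hint⟩
  -- Deviations of the indicators of the joint cells, which are the coefficients of the bilinear
  -- form in `(α, β)`.
  let c : U → V → ℝ := fun a b =>
    centeredSum μ (A.indicator fun ω => (if u ω = a then 1 else 0) * if v ω = b then 1 else 0) s
  have expand : ∀ (α : U → ℝ) (β : V → ℝ),
      centeredSum μ (A.indicator fun ω => α (u ω) * β (v ω)) s =
        ∑ a, ∑ b, α a * β b * c a b := fun α β => by
    have e : (A.indicator fun ω => α (u ω) * β (v ω)) = fun ω => ∑ a, ∑ b, α a * β b *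
        A.indicator (fun ω => (if u ω = a then (1 : ℝ) else 0) * if v ω = b then 1 else 0) ω := by
      ext ω
      by_cases h : ω ∈ A
      · simp [h]
      · simp [h]
    have hi : ∀ a b, Integrable (fun ω => α a * β b *
        A.indicator (fun ω => (if u ω = a then (1 : ℝ) else 0) * if v ω = b then 1 else 0) ω) μ :=
      fun a b => by
        refine Integrable.const_mul (integrable_of_abs_le (c := 1) (hmeas (fun a' =>
          if a' = a then 1 else 0) fun b' => if b' = b then 1 else 0) fun ω => ?_) _
        by_cases h : ω ∈ A
        · simp only [h, Set.indicator_of_mem]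
          split_ifs <;> simp
        · simp [h]
    rw [e, centeredSum_finset_sum _ fun a _ => integrable_finsetSum _ fun b _ => hi a b]
    refine Finset.sum_congr rfl fun a _ => ?_
    rw [centeredSum_finset_sum _ fun b _ => hi a b]
    exact Finset.sum_congr rfl fun b _ => centeredSum_const_mul _ _ _
  obtain ⟨σ, τ, h⟩ := exists_bilinear_le_boolSign c hδ hα hβ
  rw [← expand, ← expand (fun a => boolSign (σ a)) fun b => boolSign (τ b)] at h
  refine (ENNReal.ofReal_le_ofReal h).trans ?_
  rw [ENNReal.ofReal_mul (mul_nonneg hδ hM)]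
  gcongr
  exact hs s (σ, τ)

/-! ### Dyadic cells inside a unit cube -/

section DyadicCells

variable {D : ℕ}

lemma norm_le_card_mul {x : EuclideanSpace ℝ (Fin D)} {r : ℝ} (hx : ∀ j, |x j| ≤ r) :
    ‖x‖ ≤ D * r := by
  rcases Nat.eq_zero_or_pos D with rfl | hD
  · simp [Subsingleton.elim x 0]
  have hr : 0 ≤ r := (abs_nonneg _).trans (hx ⟨0, hD⟩)
  have hD1 : (1 : ℝ) ≤ D := by exact_mod_cast hD
  rw [EuclideanSpace.norm_eq]
  refine Real.sqrt_le_iff.2 ⟨by positivity, ?_⟩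
  calc ∑ j, ‖x j‖ ^ 2 ≤ ∑ _j : Fin D, r ^ 2 :=
        Finset.sum_le_sum fun j _ => pow_le_pow_left₀ (norm_nonneg _) (hx j) 2
    _ = D * r ^ 2 := by simp
    _ ≤ (D * r) ^ 2 := by nlinarith [mul_nonneg (sq_nonneg r) (sub_nonneg.2 hD1)]

/-- The index of the dyadic subcell of side `2⁻ᵏ`, within its unit cube, that contains `x`. -/
noncomputable def cellLabel (k : ℕ) (x : EuclideanSpace ℝ (Fin D)) : Fin D → Fin (2 ^ k) :=
  fun j => ⟨⌊(2 : ℝ) ^ k * Int.fract (x j)⌋₊, by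
    rw [Nat.floor_lt (mul_nonneg (by positivity) (Int.fract_nonneg _))]
    push_cast
    have := Int.fract_lt_one (x j)
    have h2 : (0 : ℝ) < 2 ^ k := by positivity
    nlinarith⟩

/-- The corner of the dyadic subcell with index `c` of the unit cube with corner `q`. -/
noncomputable def cellPoint (q : Fin D → ℤ) (k : ℕ) (c : Fin D → Fin (2 ^ k)) :
    EuclideanSpace ℝ (Fin D) :=
  WithLp.toLp 2 fun j => (q j : ℝ) + ((c j : ℕ) : ℝ) / 2 ^ k

/-- The index of the dyadic cell of side `2⁻ᵏ` that contains a given cell of side `2⁻ᵏ⁻¹`. -/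
def cellParent {k : ℕ} (c : Fin D → Fin (2 ^ (k + 1))) : Fin D → Fin (2 ^ k) :=
  fun j => ⟨(c j : ℕ) / 2, Nat.div_lt_of_lt_mul ((c j).2.trans_eq (pow_succ' 2 k))⟩

lemma measurable_cellLabel (k : ℕ) :
    Measurable (cellLabel k : EuclideanSpace ℝ (Fin D) → Fin D → Fin (2 ^ k)) := by
  refine measurable_pi_lambda _ fun j => ?_
  have h : Measurable fun x : EuclideanSpace ℝ (Fin D) => ⌊(2 : ℝ) ^ k * Int.fract (x j)⌋₊ :=
    Nat.measurable_floor.comp (Measurable.const_mul (measurable_fract.comp (by fun_prop)) _)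
  refine measurable_to_countable' fun a => ?_
  have : (fun x : EuclideanSpace ℝ (Fin D) => cellLabel k x j) ⁻¹' {a} =
      (fun x : EuclideanSpace ℝ (Fin D) => ⌊(2 : ℝ) ^ k * Int.fract (x j)⌋₊) ⁻¹' {(a : ℕ)} := by
    ext x
    simp [cellLabel, Fin.ext_iff]
  rw [this]
  exact h (measurableSet_singleton _)

/-- Halving commutes with the floor. Hence a step function on level `k` is also one on level `k +
1`, so chaining increments live on a single level. -/
lemma cellParent_cellLabel (k : ℕ) (x : EuclideanSpace ℝ (Fin D)) :
    cellParent (cellLabel (k + 1) x) = cellLabel k x := by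
  funext j
  ext
  simp only [cellParent, cellLabel]
  rw [← Nat.floor_div_ofNat]
  congr 1
  rw [pow_succ]
  ring

lemma dist_cellPoint_cellParent_le (q : Fin D → ℤ) (k : ℕ) (c : Fin D → Fin (2 ^ (k + 1))) :
    dist (cellPoint q (k + 1) c) (cellPoint q k (cellParent c)) ≤ D * ((1 / 2) ^ k) := by
  rw [dist_eq_norm]
  refine norm_le_card_mul fun j => ?_
  simp only [cellPoint, cellParent, PiLp.sub_apply]
  have h1 : (((c j : ℕ) / 2 : ℕ) : ℝ) * 2 ≤ (c j : ℕ) := by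
    exact_mod_cast Nat.div_mul_le_self _ _
  have h2 : ((c j : ℕ) : ℝ) ≤ (((c j : ℕ) / 2 : ℕ) : ℝ) * 2 + 1 := by
    exact_mod_cast (by omega : (c j : ℕ) ≤ (c j : ℕ) / 2 * 2 + 1)
  have h3 : (0 : ℝ) < 2 ^ k := by positivity
  have e : (q j : ℝ) + ((c j : ℕ) : ℝ) / 2 ^ (k + 1) - ((q j : ℝ) + (((c j : ℕ) / 2 : ℕ) : ℝ) / 2 ^ k)
      = (((c j : ℕ) : ℝ) - (((c j : ℕ) / 2 : ℕ) : ℝ) * 2) / 2 * (1 / 2) ^ k := by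
    rw [one_div, inv_pow, show (2 : ℝ) ^ (k + 1) = 2 ^ k * 2 from pow_succ 2 k]; field_simp; ring
  rw [e, abs_mul, abs_of_pos (show (0 : ℝ) < (1 / 2) ^ k by positivity)]
  refine mul_le_of_le_one_left (by positivity) ?_
  rw [abs_le]
  constructor <;> linarith

lemma dist_cellPoint_cellLabel_le {q : Fin D → ℤ} {x : EuclideanSpace ℝ (Fin D)}
    (hx : ∀ j, ⌊x j⌋ = q j) (k : ℕ) :
    dist x (cellPoint q k (cellLabel k x)) ≤ D * ((1 / 2) ^ k) := by
  rw [dist_eq_norm]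
  refine norm_le_card_mul fun j => ?_
  simp only [cellPoint, cellLabel, PiLp.sub_apply]
  have h3 : (0 : ℝ) < 2 ^ k := by positivity
  have h0 : 0 ≤ (2 : ℝ) ^ k * Int.fract (x j) := mul_nonneg h3.le (Int.fract_nonneg _)
  have h1 := Nat.floor_le h0
  have h2 := Nat.lt_floor_add_one ((2 : ℝ) ^ k * Int.fract (x j))
  set m : ℝ := ((⌊(2 : ℝ) ^ k * Int.fract (x j)⌋₊ : ℕ) : ℝ)
  have e : x j - ((q j : ℝ) + m / 2 ^ k) = (2 ^ k * Int.fract (x j) - m) * (1 / 2) ^ k := by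
    rw [← hx j, one_div, inv_pow, ← Int.self_sub_floor]; field_simp; ring
  rw [e, abs_mul, abs_of_pos (show (0 : ℝ) < (1 / 2) ^ k by positivity)]
  refine mul_le_of_le_one_left (by positivity) ?_
  rw [abs_le]
  constructor <;> linarith

end DyadicCells

/-! ### Chaining on a pair of unit cubes -/

/-- The choice of the finest dyadic scale that balances the chaining bound. -/
lemma exists_scale {D n : ℕ} (hD : 0 < D) (hn : 0 < n) :
    ∃ K : ℕ, (1 / 2 : ℝ) ^ K ≤ 2 * (n : ℝ) ^ (-(1 / (1 + (D : ℝ)))) ∧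
      ∀ k ≤ K, (1 / 2 : ℝ) ^ k * √((1 + 2 * (2 ^ k) ^ D) * n) ≤
        2 * (n * (n : ℝ) ^ (-(1 / (1 + (D : ℝ))))) * (3 / 4) ^ k := by
  have hn1 : (1 : ℝ) ≤ n := by exact_mod_cast hn
  set r : ℝ := (n : ℝ) ^ (1 / (1 + (D : ℝ))) with hr
  have hr1 : 1 ≤ r := Real.one_le_rpow hn1 (by positivity)
  have hr0 : 0 < r := by linarith
  have hrn : r ^ (D + 1) = n := by
    rw [hr, ← Real.rpow_natCast, ← Real.rpow_mul (by positivity)]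
    push_cast
    rw [show 1 / (1 + (D : ℝ)) * ((D : ℝ) + 1) = 1 by field_simp; ring, Real.rpow_one]
  rw [Real.rpow_neg (by positivity), ← hr]
  -- `K` is the last level with `2 ^ K ≤ r`, where `r ^ (D + 1) = n`. The cell side is then within a
  -- factor `2` of the target rate `r⁻¹`.
  obtain ⟨K, hK1, hK2⟩ := exists_nat_pow_near hr1 (one_lt_two)
  refine ⟨K, ?_, fun k hk => ?_⟩
  · rw [one_div, inv_pow, ← div_eq_mul_inv, inv_le_comm₀ (by positivity) (by positivity), inv_div]
    rw [pow_succ] at hK2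
    linarith
  · have hkr : (2 : ℝ) ^ k ≤ r := (pow_le_pow_right₀ one_le_two hk).trans hK1
    have hnr : (n : ℝ) * r⁻¹ = r ^ D := by rw [← hrn, pow_succ]; field_simp
    rw [hnr]
    refine le_of_sq_le_sq ?_ (by positivity)
    rw [mul_pow, Real.sq_sqrt (by positivity), ← hrn]
    obtain ⟨d, rfl⟩ := Nat.exists_eq_succ_of_ne_zero hD.ne'
    set y : ℝ := 2 ^ k with hy
    have hy1 : 1 ≤ y := one_le_pow₀ one_le_two
    have e1 : ((1 / 2 : ℝ) ^ k) ^ 2 = (y⁻¹) ^ 2 := by rw [one_div, inv_pow]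
    -- After squaring, using `y ≤ r` in all but one of the powers leaves a spare `y⁻¹ = 2 ^ (-k)`.
    -- Since `1 / 2 ≤ 9 / 16`, this yields geometric decay in `k` for every `D ≥ 1`.
    have e2 : y⁻¹ ≤ ((3 / 4 : ℝ) ^ k) ^ 2 := by
      rw [hy, ← inv_pow, ← pow_mul, mul_comm k 2, pow_mul]
      exact pow_le_pow_left₀ (by norm_num) (by norm_num) _
    have e3 : y ^ d ≤ r ^ d := pow_le_pow_left₀ (by positivity) hkr d
    have e4 : 1 ≤ y ^ (d + 1) := one_le_pow₀ hy1
    rw [e1]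
    calc (y⁻¹) ^ 2 * ((1 + 2 * y ^ (d + 1)) * r ^ (d + 1 + 1))
        ≤ (y⁻¹) ^ 2 * ((4 * y ^ (d + 1)) * r ^ (d + 1 + 1)) := by gcongr; linarith
      _ = 4 * (y ^ d * r ^ (d + 2)) * y⁻¹ := by field_simp; ring
      _ ≤ 4 * (r ^ d * r ^ (d + 2)) * ((3 / 4 : ℝ) ^ k) ^ 2 := by gcongr
      _ = (2 * r ^ (d + 1) * (3 / 4) ^ k) ^ 2 := by ring

lemma ofReal_abs_centeredSum_add_le {Ω : Type*} [MeasurableSpace Ω] {μ : Measure Ω} {n : ℕ}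
    {φ ψ : Ω → ℝ} (hφ : Integrable φ μ) (hψ : Integrable ψ μ) (s : Fin n → Ω) :
    ENNReal.ofReal |centeredSum μ (fun ω => φ ω + ψ ω) s| ≤
      ENNReal.ofReal |centeredSum μ φ s| + ENNReal.ofReal |centeredSum μ ψ s| := by
  rw [centeredSum_add hφ hψ, ← ENNReal.ofReal_add (abs_nonneg _) (abs_nonneg _)]
  exact ENNReal.ofReal_le_ofReal (abs_add_le _ _)

section Chaining

variable {D n : ℕ} {Ω : Type*} [MeasurableSpace Ω] {μ : Measure Ω} [IsProbabilityMeasure μ]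
  {X W : Ω → EuclideanSpace ℝ (Fin D)}

/-- The value of `a` at the corner of the dyadic cell of side `2⁻ᵏ` that contains `x`. -/
noncomputable def dyadicApprox (q : Fin D → ℤ) (a : EuclideanSpace ℝ (Fin D) → ℝ) (k : ℕ)
    (x : EuclideanSpace ℝ (Fin D)) : ℝ :=
  a (cellPoint q k (cellLabel k x))

lemma measurable_dyadicApprox (q : Fin D → ℤ) (a : EuclideanSpace ℝ (Fin D) → ℝ) (k : ℕ) :
    Measurable (dyadicApprox q a k) :=
  (Measurable.of_discrete (f := fun c => a (cellPoint q k c))).comp (measurable_cellLabel k)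

lemma integrable_indicator_mul (hX : Measurable X) (hW : Measurable W) {A : Set Ω}
    (hA : MeasurableSet A) {a b : EuclideanSpace ℝ (Fin D) → ℝ} (ha : Measurable a)
    (hb : Measurable b) {M M' : ℝ} (haM : ∀ x, |a x| ≤ M) (hbM : ∀ x, |b x| ≤ M') :
    Integrable (A.indicator fun ω => a (X ω) * b (W ω)) μ := by
  refine Integrable.indicator (integrable_of_abs_le (c := M * M')
    ((ha.comp hX).mul (hb.comp hW)) fun ω => ?_) hA
  rw [abs_mul]
  exact mul_le_mul (haM _) (hbM _) (abs_nonneg _) ((abs_nonneg _).trans (haM (X ω)))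

/-- Chaining: the deviation of a dyadic approximation of a product of two Lipschitz functions is
dominated by the deviations of products of step functions. -/
lemma ofReal_abs_centeredSum_dyadicApprox_le (hX : Measurable X) (hW : Measurable W)
    {A : Set Ω} (hA : MeasurableSet A) (q q' : Fin D → ℤ) {H : ℕ → (Fin n → Ω) → ℝ≥0∞}
    (hH : ∀ (k : ℕ) (α β : (Fin D → Fin (2 ^ k)) → ℝ) (δ M : ℝ), 0 ≤ δ → 0 ≤ M →
      (∀ c, |α c| ≤ δ) → (∀ c, |β c| ≤ M) → ∀ s : Fin n → Ω,
      ENNReal.ofReal |centeredSum μ (A.indicator fun ω =>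
        α (cellLabel k (X ω)) * β (cellLabel k (W ω))) s| ≤ ENNReal.ofReal (δ * M) * H k s)
    {L : ℝ≥0} {M : ℝ} (hM : 0 ≤ M) {a b : EuclideanSpace ℝ (Fin D) → ℝ}
    (ha : LipschitzWith L a) (hb : LipschitzWith L b) (haM : ∀ x, |a x| ≤ M)
    (hbM : ∀ x, |b x| ≤ M) (s : Fin n → Ω) (K : ℕ) :
    ENNReal.ofReal |centeredSum μ (A.indicator fun ω =>
        dyadicApprox q a K (X ω) * dyadicApprox q' b K (W ω)) s| ≤
      ENNReal.ofReal (M * M) * H 0 s +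
        ∑ k ∈ Finset.range K, ENNReal.ofReal (2 * (L * (D * (1 / 2) ^ k) * M)) * H (k + 1) s := by
  have hdiff : ∀ (q : Fin D → ℤ) {a : EuclideanSpace ℝ (Fin D) → ℝ}, LipschitzWith L a →
      ∀ (k : ℕ) (c : Fin D → Fin (2 ^ (k + 1))),
      |a (cellPoint q (k + 1) c) - a (cellPoint q k (cellParent c))| ≤
        L * (D * (1 / 2) ^ k) := fun q a ha k c => by
    rw [← Real.dist_eq]
    exact (ha.dist_le_mul _ _).trans
      (mul_le_mul_of_nonneg_left (dist_cellPoint_cellParent_le q k c) L.2)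
  induction K with
  | zero =>
    simpa [dyadicApprox] using hH 0 (fun c => a (cellPoint q 0 c))
      (fun c => b (cellPoint q' 0 c)) M M hM hM (fun _ => haM _) (fun _ => hbM _) s
  | succ K ih =>
    have hδ : (0 : ℝ) ≤ L * (D * (1 / 2) ^ K) := by positivity
    have hδM : (0 : ℝ) ≤ L * (D * (1 / 2) ^ K) * M := mul_nonneg hδ hM
    -- Discrete product rule: `a' b' - a b = (a' - a) b' + a (b' - b)`. Each increment is a product
    -- of step functions with one factor of size `L * D * 2 ^ (-K)`.
    have e : (A.indicator fun ω =>
        dyadicApprox q a (K + 1) (X ω) * dyadicApprox q' b (K + 1) (W ω)) = fun ω =>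
        A.indicator (fun ω => dyadicApprox q a K (X ω) * dyadicApprox q' b K (W ω)) ω +
        (A.indicator (fun ω => (dyadicApprox q a (K + 1) (X ω) - dyadicApprox q a K (X ω)) *
            dyadicApprox q' b (K + 1) (W ω)) ω +
          A.indicator (fun ω => dyadicApprox q a K (X ω) *
            (dyadicApprox q' b (K + 1) (W ω) - dyadicApprox q' b K (W ω))) ω) := by
      ext ω
      by_cases h : ω ∈ A
      · simp only [h, Set.indicator_of_mem]; ring
      · simp [h]
    have mA := measurable_dyadicApprox q a
    have mB := measurable_dyadicApprox q' b
    have hsub : ∀ {x y : ℝ}, |x| ≤ M → |y| ≤ M → |x - y| ≤ M + M := fun hx hy =>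
      (abs_sub _ _).trans (add_le_add hx hy)
    have i0 := integrable_indicator_mul (μ := μ) hX hW hA (mA K) (mB K)
      (fun _ => haM _) (fun _ => hbM _)
    have i1 := integrable_indicator_mul (μ := μ) hX hW hA ((mA (K + 1)).sub (mA K)) (mB (K + 1))
      (fun _ => hsub (haM _) (haM _)) (fun _ => hbM _)
    have i2 := integrable_indicator_mul (μ := μ) hX hW hA (mA K) ((mB (K + 1)).sub (mB K))
      (fun _ => haM _) (fun _ => hsub (hbM _) (hbM _))
    have h1 := hH (K + 1)
      (fun c => a (cellPoint q (K + 1) c) - a (cellPoint q K (cellParent c)))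
      (fun c => b (cellPoint q' (K + 1) c)) _ M hδ hM (hdiff q ha K) (fun _ => hbM _) s
    have h2 := hH (K + 1) (fun c => a (cellPoint q K (cellParent c)))
      (fun c => b (cellPoint q' (K + 1) c) - b (cellPoint q' K (cellParent c))) M _ hM hδ
      (fun _ => haM _) (hdiff q' hb K) s
    -- Identifies the parent's corner with the level-`K` corner, so that both products are measured
    -- by the level-`K + 1` envelope.
    simp only [cellParent_cellLabel] at h1 h2
    rw [e, Finset.sum_range_succ, ← add_assoc]
    refine (ofReal_abs_centeredSum_add_le i0 (i1.add i2) s).trans (add_le_add ih ?_)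
    refine (ofReal_abs_centeredSum_add_le i1 i2 s).trans ((add_le_add h1 h2).trans_eq ?_)
    rw [← add_mul, mul_comm M, ← ENNReal.ofReal_add hδM hδM, two_mul]

/-- Uniform deviation bound for products of Lipschitz functions, localized to a product of two
unit cubes. -/
lemma exists_unitCube_bound (hD : 0 < D) (hn : 0 < n) (hX : Measurable X) (hW : Measurable W)
    (q q' : Fin D → ℤ) (L : ℝ≥0) {M : ℝ} (hM : 0 ≤ M) {A : Set Ω} (hA : MeasurableSet A)
    (hAX : ∀ ω ∈ A, ∀ j, ⌊X ω j⌋ = q j) (hAW : ∀ ω ∈ A, ∀ j, ⌊W ω j⌋ = q' j) :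
    ∃ H : (Fin n → Ω) → ℝ≥0∞, Measurable H ∧
      (∀ a b : EuclideanSpace ℝ (Fin D) → ℝ, LipschitzWith L a → LipschitzWith L b →
        (∀ x, |a x| ≤ M) → (∀ x, |b x| ≤ M) → ∀ s : Fin n → Ω,
        ENNReal.ofReal |centeredSum μ (A.indicator fun ω => a (X ω) * b (W ω)) s| ≤ H s) ∧
      ∫⁻ s, H s ∂(Measure.pi fun _ => μ) ≤
        ENNReal.ofReal ((6 * M ^ 2 + 104 * (L * D * M)) *
          (n * (n : ℝ) ^ (-(1 / (1 + (D : ℝ))))) * √(μ.real A)) := by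
  choose H hHm hH hHint using fun k : ℕ => exists_bilinear_bound (n := n) (μ := μ)
    ((measurable_cellLabel k).comp hX) ((measurable_cellLabel k).comp hW) hA
  obtain ⟨R, hRm, hR, hRint⟩ := exists_indicator_bound (n := n) (μ := μ) hA
  obtain ⟨K, hK, hk⟩ := exists_scale hD hn
  set p := μ.real A with hp
  set ρ := (n : ℝ) ^ (-(1 / (1 + (D : ℝ)))) with hρ
  have hρ0 : 0 ≤ ρ := by positivity
  have hp0 : 0 ≤ p := measureReal_nonneg
  have hp1 : p ≤ √p := Real.le_sqrt_of_sq_le (by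
    have : p ≤ 1 := measureReal_le_one
    nlinarith)
  have hLDM : 0 ≤ L * D * M := by positivity
  -- The coarsest level, the chaining increments, and the approximation error at scale `K`, for
  -- which only the crude indicator envelope `R` is needed.
  refine ⟨fun s => (ENNReal.ofReal (M * M) * H 0 s + ∑ k ∈ Finset.range K,
    ENNReal.ofReal (2 * (L * (D * (1 / 2) ^ k) * M)) * H (k + 1) s) +
      ENNReal.ofReal (2 * (L * (D * (1 / 2) ^ K) * M)) * R s, ?_, ?_, ?_⟩
  · exact (((hHm 0).const_mul _).add (Finset.measurable_sum _ fun k _ =>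
      (hHm (k + 1)).const_mul _)).add (hRm.const_mul _)
  · intro a b ha hb haM hbM s
    have e : (A.indicator fun ω => a (X ω) * b (W ω)) = fun ω =>
        A.indicator (fun ω => dyadicApprox q a K (X ω) * dyadicApprox q' b K (W ω)) ω +
        A.indicator (fun ω => a (X ω) * b (W ω) -
          dyadicApprox q a K (X ω) * dyadicApprox q' b K (W ω)) ω := by
      ext ω
      by_cases h : ω ∈ A
      · simp only [h, Set.indicator_of_mem]; ring
      · simp [h]
    have i0 := integrable_indicator_mul (μ := μ) hX hW hA (measurable_dyadicApprox q a K)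
      (measurable_dyadicApprox q' b K) (fun _ => haM _) (fun _ => hbM _)
    have i1 := integrable_indicator_mul (μ := μ) hX hW hA ha.continuous.measurable
      hb.continuous.measurable haM hbM
    have i2 : Integrable (A.indicator (fun ω => a (X ω) * b (W ω) -
        dyadicApprox q a K (X ω) * dyadicApprox q' b K (W ω))) μ := by
      convert! i1.sub i0 using 1
      ext ω
      by_cases h : ω ∈ A <;> simp [h]
    rw [e]
    refine (ofReal_abs_centeredSum_add_le i0 i2 s).trans (add_le_add
      (ofReal_abs_centeredSum_dyadicApprox_le hX hW hA q q' hH hM ha hb haM hbM s K)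
      (hR _ _ (by positivity) (fun ω => ?_) s))
    by_cases h : ω ∈ A
    · simp only [h, Set.indicator_of_mem, Pi.one_apply, mul_one]
      -- Only the approximation error uses that `X` and `W` lie in the cubes `q` and `q'` on `A`;
      -- the increments compare corners with corners.
      have h1 : |a (X ω) - dyadicApprox q a K (X ω)| ≤ L * (D * (1 / 2) ^ K) := by
        rw [← Real.dist_eq]
        exact (ha.dist_le_mul _ _).trans
          (mul_le_mul_of_nonneg_left (dist_cellPoint_cellLabel_le (hAX ω h) K) L.2)
      have h2 : |b (W ω) - dyadicApprox q' b K (W ω)| ≤ L * (D * (1 / 2) ^ K) := by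
        rw [← Real.dist_eq]
        exact (hb.dist_le_mul _ _).trans
          (mul_le_mul_of_nonneg_left (dist_cellPoint_cellLabel_le (hAW ω h) K) L.2)
      have h3 : |dyadicApprox q a K (X ω)| ≤ M := haM _
      have h4 := hbM (W ω)
      rw [show a (X ω) * b (W ω) - dyadicApprox q a K (X ω) * dyadicApprox q' b K (W ω) =
        (a (X ω) - dyadicApprox q a K (X ω)) * b (W ω) +
          (b (W ω) - dyadicApprox q' b K (W ω)) * dyadicApprox q a K (X ω) by ring]
      refine (abs_add_le _ _).trans ?_
      rw [abs_mul, abs_mul, two_mul]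
      exact add_le_add (mul_le_mul h1 h4 (abs_nonneg _) (by positivity))
        (mul_le_mul h2 h3 (abs_nonneg _) (by positivity))
    · simp [h]
  · have hlev : ∀ k ≤ K, (1 / 2 : ℝ) ^ k * (3 * √((1 + Fintype.card (Fin D → Fin (2 ^ k)) +
        Fintype.card (Fin D → Fin (2 ^ k))) * (n * p))) ≤ 6 * (n * ρ) * √p * (3 / 4) ^ k := by
      intro k hkK
      have h := mul_le_mul_of_nonneg_right (hk k hkK) (Real.sqrt_nonneg p)
      rw [mul_assoc, ← Real.sqrt_mul (by positivity)] at h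
      simp only [Fintype.card_pi, Fintype.card_fin, Finset.prod_const, Finset.card_univ]
      push_cast
      rw [show (1 + ((2 : ℝ) ^ k) ^ D + (2 ^ k) ^ D) * (n * p) = (1 + 2 * (2 ^ k) ^ D) * n * p by
        ring]
      linarith
    rw [lintegral_add_right _ (hRm.const_mul _), lintegral_add_left ((hHm 0).const_mul _),
      lintegral_const_mul _ (hHm 0), lintegral_const_mul _ hRm,
      lintegral_finsetSum _ fun k _ => (hHm (k + 1)).const_mul _]
    have t0 : ENNReal.ofReal (M * M) * ∫⁻ s, H 0 s ∂(Measure.pi fun _ => μ) ≤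
        ENNReal.ofReal (6 * M ^ 2 * (n * ρ) * √p) := by
      refine (mul_le_mul_right (hHint 0) _).trans ?_
      rw [← ENNReal.ofReal_mul (by positivity)]
      refine ENNReal.ofReal_le_ofReal ?_
      have := mul_le_mul_of_nonneg_left (hlev 0 (Nat.zero_le _)) (mul_self_nonneg M)
      simp only [pow_zero, one_mul, mul_one] at this ⊢
      linarith
    have t1 : ∀ k ∈ Finset.range K, ∫⁻ s, ENNReal.ofReal (2 * (L * (D * (1 / 2) ^ k) * M)) *
        H (k + 1) s ∂(Measure.pi fun _ => μ) ≤
        ENNReal.ofReal (24 * (L * D * M) * (n * ρ) * √p * (3 / 4) ^ k) := by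
      intro k hkK
      rw [lintegral_const_mul _ (hHm (k + 1))]
      refine (mul_le_mul_right (hHint (k + 1)) _).trans ?_
      rw [← ENNReal.ofReal_mul (by positivity)]
      refine ENNReal.ofReal_le_ofReal ?_
      have h1 := mul_le_mul_of_nonneg_left (hlev (k + 1) (Finset.mem_range.1 hkK)) hLDM
      have h2 : 0 ≤ L * D * M * (6 * (n * ρ) * √p * (3 / 4) ^ k) := by positivity
      rw [pow_succ (1 / 2 : ℝ) k, pow_succ (3 / 4 : ℝ) k] at h1
      linarith
    have t2 : ENNReal.ofReal (2 * (L * (D * (1 / 2) ^ K) * M)) *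
        ∫⁻ s, R s ∂(Measure.pi fun _ => μ) ≤ ENNReal.ofReal (8 * (L * D * M) * (n * ρ) * √p) := by
      refine (mul_le_mul_right hRint _).trans ?_
      rw [← ENNReal.ofReal_mul (by positivity)]
      refine ENNReal.ofReal_le_ofReal ?_
      have h1 : (1 / 2 : ℝ) ^ K * p ≤ 2 * ρ * √p :=
        mul_le_mul hK hp1 hp0 (by positivity)
      have h2 := mul_le_mul_of_nonneg_left h1 (show 0 ≤ 4 * (L * D * M) * n by positivity)
      linarith
    refine (add_le_add (add_le_add t0 (Finset.sum_le_sum t1)) t2).trans ?_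
    rw [← ENNReal.ofReal_sum_of_nonneg fun k _ => by positivity,
      ← ENNReal.ofReal_add (by positivity) (Finset.sum_nonneg fun k _ => by positivity),
      ← ENNReal.ofReal_add (add_nonneg (by positivity) (Finset.sum_nonneg fun k _ => by positivity))
        (by positivity), ← Finset.mul_sum]
    refine ENNReal.ofReal_le_ofReal ?_
    -- The constant `104` is `24 * 4` from the increments plus `8` from the approximation error.
    have hgeo : ∑ k ∈ Finset.range K, (3 / 4 : ℝ) ^ k ≤ 4 := by
      rw [geom_sum_eq (by norm_num), div_le_iff_of_neg (by norm_num)]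
      have : (0 : ℝ) < (3 / 4) ^ K := by positivity
      linarith
    have := mul_le_mul_of_nonneg_left hgeo
      (show 0 ≤ 24 * (L * D * M) * (n * ρ) * √p by positivity)
    linarith

end Chaining

/-! ### Summation over the lattice of unit cubes -/

lemma tsum_fin_prod {α : Type*} (g : α → ℝ≥0∞) (D : ℕ) :
    ∑' q : Fin D → α, ∏ j, g (q j) = (∑' m, g m) ^ D := by
  induction D with
  | zero => simp
  | succ D ih =>
    rw [← (Fin.consEquiv fun _ : Fin (D + 1) => α).tsum_eq, ENNReal.tsum_prod', pow_succ', ← ih]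
    simp only [Fin.consEquiv_apply, Fin.prod_univ_succ, Fin.cons_zero, Fin.cons_succ,
      ENNReal.tsum_mul_left, ENNReal.tsum_mul_right]

lemma tsum_exp_neg_abs_ne_top : ∑' m : ℤ, ENNReal.ofReal (Real.exp (-|(m : ℝ)|)) ≠ ⊤ := by
  refine Summable.tsum_ofReal_ne_top ?_
  refine Summable.of_nat_of_neg ?_ ?_ <;> simpa using Real.summable_exp_neg_nat

/-- The exponential weight of a lattice point. -/
noncomputable def latticeWeight {D : ℕ} (q : Fin D → ℤ) : ℝ := Real.exp (∑ j, |(q j : ℝ)|)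

lemma latticeWeight_pos {D : ℕ} (q : Fin D → ℤ) : 0 < latticeWeight q := Real.exp_pos _

lemma tsum_inv_latticeWeight_ne_top (D : ℕ) :
    ∑' q : (Fin D → ℤ) × (Fin D → ℤ),
      ENNReal.ofReal (latticeWeight q.1 * latticeWeight q.2)⁻¹ ≠ ⊤ := by
  have h : ∀ q : Fin D → ℤ, ENNReal.ofReal (latticeWeight q)⁻¹ =
      ∏ j, ENNReal.ofReal (Real.exp (-|(q j : ℝ)|)) := fun q => by
    rw [latticeWeight, ← Real.exp_neg, ← Finset.sum_neg_distrib, Real.exp_sum,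
      ENNReal.ofReal_prod_of_nonneg fun j _ => (Real.exp_pos _).le]
  have h2 : ∀ q : (Fin D → ℤ) × (Fin D → ℤ),
      ENNReal.ofReal (latticeWeight q.1 * latticeWeight q.2)⁻¹ =
        ENNReal.ofReal (latticeWeight q.1)⁻¹ * ENNReal.ofReal (latticeWeight q.2)⁻¹ := fun q => by
    rw [mul_inv, ENNReal.ofReal_mul (inv_nonneg.2 (latticeWeight_pos _).le)]
  simp only [h2]
  rw [ENNReal.tsum_prod' (f := fun q : (Fin D → ℤ) × (Fin D → ℤ) =>
    ENNReal.ofReal (latticeWeight q.1)⁻¹ * ENNReal.ofReal (latticeWeight q.2)⁻¹)]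
  have h3 : ∑' q : Fin D → ℤ, ENNReal.ofReal (latticeWeight q)⁻¹ ≠ ⊤ := by
    rw [tsum_congr h, tsum_fin_prod fun m : ℤ => ENNReal.ofReal (Real.exp (-|(m : ℝ)|))]
    exact ENNReal.pow_ne_top tsum_exp_neg_abs_ne_top
  simp only [ENNReal.tsum_mul_left, ENNReal.tsum_mul_right]
  exact ENNReal.mul_ne_top h3 h3

/-- Each of the `D` coordinates contributes at most `‖x‖ + 1`; this fixes the exponent `D * ‖X‖ + D
* ‖W‖` in the moment condition. -/
lemma latticeWeight_le {D : ℕ} {q : Fin D → ℤ} {x : EuclideanSpace ℝ (Fin D)}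
    (hx : ∀ j, ⌊x j⌋ = q j) : latticeWeight q ≤ Real.exp (D * ‖x‖ + D) := by
  refine Real.exp_le_exp.2 ?_
  calc ∑ j, |(q j : ℝ)| ≤ ∑ _j : Fin D, (‖x‖ + 1) := Finset.sum_le_sum fun j _ => by
        have h0 : |x j| ≤ ‖x‖ := PiLp.norm_apply_le x j
        have h1 := abs_le.1 h0
        rw [← hx j, abs_le]
        have h2 := Int.floor_le (x j)
        have h3 := Int.lt_floor_add_one (x j)
        constructor <;> linarith
    _ = D * ‖x‖ + D := by simp

lemma hasSum_indicator_of_fibers {Ω ι : Type*} (g : Ω → ℝ) (N : Ω → ι) (ω : Ω) :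
    HasSum (fun q => (N ⁻¹' {q}).indicator g ω) (g ω) := by
  convert hasSum_single (f := fun q => (N ⁻¹' {q}).indicator g ω) (N ω) fun q hq => ?_ using 1
  · simp
  · simp [hq.symm]

/-- The deviation of a function is the sum of the deviations of its restrictions to the fibers of
a countable-valued map. -/
lemma hasSum_centeredSum_fibers {Ω ι : Type*} [MeasurableSpace Ω] {μ : Measure Ω} {n : ℕ} [Countable ι] [MeasurableSpace ι]
    [MeasurableSingletonClass ι] {g : Ω → ℝ} (hg : Integrable g μ) {N : Ω → ι}
    (hN : Measurable N) (s : Fin n → Ω) :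
    HasSum (fun q => centeredSum μ ((N ⁻¹' {q}).indicator g) s) (centeredSum μ g s) := by
  have hm : ∀ q, MeasurableSet (N ⁻¹' {q}) := fun q => hN (measurableSet_singleton q)
  refine hasSum_sum fun i _ => (hasSum_indicator_of_fibers g N (s i)).sub ?_
  have h := hasSum_integral_iUnion (μ := μ) (f := g) hm
    (fun q q' h => Disjoint.preimage _ (by simpa using h)) hg.integrableOn
  have hU : ⋃ q, N ⁻¹' {q} = Set.univ := by ext; simp
  rw [hU, setIntegral_univ] at h
  simpa only [integral_indicator (hm _)] using h

lemma ofReal_abs_le_tsum {ι : Type*} {f : ι → ℝ} {x : ℝ} (hf : HasSum f x) :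
    ENNReal.ofReal |x| ≤ ∑' q, ENNReal.ofReal |f q| := by
  have := enorm_tsum_le_tsum_enorm (f := f)
  rw [hf.tsum_eq] at this
  simpa only [← ofReal_norm, Real.norm_eq_abs] using this

/-- Makes `∑ √p` over cubes finite: with exponential weights, `∑ w * p` is an exponential moment and
`∑ w⁻¹` converges. -/
lemma sqrt_le_mul_add_inv {p w : ℝ} (hp : 0 ≤ p) (hw : 0 < w) : √p ≤ w * p + w⁻¹ := by
  refine Real.sqrt_le_iff.2 ⟨by positivity, ?_⟩
  have : w * w⁻¹ = 1 := mul_inv_cancel₀ hw.ne'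
  nlinarith [sq_nonneg (w * p), sq_nonneg w⁻¹]

/-- Uniform law of large numbers with rate `n ^ (-1 / (1 + D))` for products of two bounded
Lipschitz functions on `ℝᴰ`, under an exponential moment condition. -/
theorem exists_lipschitz_mul_deviation_bound (D : ℕ) (L : ℝ≥0) {M B : ℝ} (hM : 0 ≤ M)
    (hB : 0 ≤ B) :
    ∃ C : ℝ, 0 ≤ C ∧ ∀ (Ω : Type) [MeasurableSpace Ω] (μ : Measure Ω) [IsProbabilityMeasure μ]
      (X W : Ω → EuclideanSpace ℝ (Fin D)) (n : ℕ), 0 < n → Measurable X → Measurable W →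
      ∫⁻ ω, ENNReal.ofReal (Real.exp (D * ‖X ω‖ + D * ‖W ω‖)) ∂μ ≤ ENNReal.ofReal B →
      ∃ H : (Fin n → Ω) → ℝ≥0∞, Measurable H ∧
        (∀ a b : EuclideanSpace ℝ (Fin D) → ℝ, LipschitzWith L a → LipschitzWith L b →
          (∀ x, |a x| ≤ M) → (∀ x, |b x| ≤ M) → ∀ s : Fin n → Ω,
          ENNReal.ofReal |(∫ ω, a (X ω) * b (W ω) ∂μ) -
            1 / (n : ℝ) * ∑ i, a (X (s i)) * b (W (s i))| ≤ H s) ∧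
        ∫⁻ s, H s ∂(Measure.pi fun _ => μ) ≤
          ENNReal.ofReal (C * (n : ℝ) ^ (-(1 / (1 + (D : ℝ))))) := by
  set S : ℝ := (∑' q : (Fin D → ℤ) × (Fin D → ℤ),
      ENNReal.ofReal (latticeWeight q.1 * latticeWeight q.2)⁻¹).toReal with hS
  set C₁ : ℝ := 6 * M ^ 2 + 104 * (L * D * M) with hC₁
  have hC₁0 : 0 ≤ C₁ := by positivity
  have hS0 : 0 ≤ S := ENNReal.toReal_nonneg
  refine ⟨C₁ * (Real.exp (2 * D) * B + S), by positivity, ?_⟩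
  intro Ω _ μ _ X W n hn hX hW hmom
  have hn0 : (0 : ℝ) < n := by exact_mod_cast hn
  -- In dimension `0` every function is constant and the deviation vanishes; the choice of scale
  -- needs `0 < D`.
  rcases Nat.eq_zero_or_pos D with rfl | hD
  · refine ⟨0, measurable_zero, fun a b _ _ _ _ s => ?_, by simp⟩
    have : ∀ ω, a (X ω) * b (W ω) = a 0 * b 0 := fun ω => by
      rw [Subsingleton.elim (X ω) 0, Subsingleton.elim (W ω) 0]
    simp only [this]
    have h1 : (n : ℝ)⁻¹ * (n * (a 0 * b 0)) = a 0 * b 0 := by field_simp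
    simp [h1]
  set ρ := (n : ℝ) ^ (-(1 / (1 + (D : ℝ)))) with hρ
  have hρ0 : 0 ≤ ρ := by positivity
  -- The pair of unit cubes containing `X ω` and `W ω`; its fibers are the localization sets.
  let N : Ω → (Fin D → ℤ) × (Fin D → ℤ) := fun ω => (fun j => ⌊X ω j⌋, fun j => ⌊W ω j⌋)
  have hN : Measurable N := by
    refine Measurable.prodMk (measurable_pi_lambda _ fun j => ?_)
      (measurable_pi_lambda _ fun j => ?_)
    · exact Int.measurable_floor.comp
        ((by fun_prop : Measurable fun x : EuclideanSpace ℝ (Fin D) => x j).comp hX)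
    · exact Int.measurable_floor.comp
        ((by fun_prop : Measurable fun x : EuclideanSpace ℝ (Fin D) => x j).comp hW)
  have hA : ∀ q, MeasurableSet (N ⁻¹' {q}) := fun q => hN (measurableSet_singleton q)
  have hAX : ∀ q, ∀ ω ∈ N ⁻¹' {q}, ∀ j, ⌊X ω j⌋ = q.1 j := fun q ω h j =>
    congrFun (congrArg Prod.fst h) j
  have hAW : ∀ q, ∀ ω ∈ N ⁻¹' {q}, ∀ j, ⌊W ω j⌋ = q.2 j := fun q ω h j =>
    congrFun (congrArg Prod.snd h) j
  choose H hHm hH hHint using fun q => exists_unitCube_bound (μ := μ) hD hn hX hW q.1 q.2 L hM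
    (hA q) (hAX q) (hAW q)
  refine ⟨fun s => ENNReal.ofReal (n : ℝ)⁻¹ * ∑' q, H q s,
    (Measurable.tsum hHm).const_mul _, ?_, ?_⟩
  · intro a b ha hb haM hbM s
    have hi : Integrable (fun ω => a (X ω) * b (W ω)) μ := by
      simpa using integrable_indicator_mul (μ := μ) hX hW MeasurableSet.univ
        ha.continuous.measurable hb.continuous.measurable haM hbM
    have e : (∫ ω, a (X ω) * b (W ω) ∂μ) - 1 / (n : ℝ) * ∑ i, a (X (s i)) * b (W (s i)) =
        -((n : ℝ)⁻¹ * centeredSum μ (fun ω => a (X ω) * b (W ω)) s) := by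
      rw [centeredSum, Finset.sum_sub_distrib]
      simp only [Finset.sum_const, Finset.card_univ, Fintype.card_fin, nsmul_eq_mul]
      field_simp
      ring
    rw [e, abs_neg, abs_mul, abs_of_pos (inv_pos.2 hn0), ENNReal.ofReal_mul (inv_pos.2 hn0).le]
    refine mul_le_mul_right ?_ _
    refine (ofReal_abs_le_tsum (hasSum_centeredSum_fibers hi hN s)).trans ?_
    exact ENNReal.tsum_le_tsum fun q => hH q a b ha hb haM hbM s
  · have hw : ∀ q : (Fin D → ℤ) × (Fin D → ℤ), 0 < latticeWeight q.1 * latticeWeight q.2 :=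
      fun q => mul_pos (latticeWeight_pos _) (latticeWeight_pos _)
    have hsum : ∑' q, ENNReal.ofReal (√(μ.real (N ⁻¹' {q}))) ≤
        ENNReal.ofReal (Real.exp (2 * D) * B + S) := by
      rw [ENNReal.ofReal_add (by positivity) hS0, hS,
        ENNReal.ofReal_toReal (tsum_inv_latticeWeight_ne_top D)]
      calc ∑' q, ENNReal.ofReal (√(μ.real (N ⁻¹' {q})))
          ≤ ∑' q, (ENNReal.ofReal (latticeWeight q.1 * latticeWeight q.2) * μ (N ⁻¹' {q}) +
              ENNReal.ofReal (latticeWeight q.1 * latticeWeight q.2)⁻¹) := by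
            refine ENNReal.tsum_le_tsum fun q => ?_
            refine (ENNReal.ofReal_le_ofReal
              (sqrt_le_mul_add_inv measureReal_nonneg (hw q))).trans ?_
            rw [ENNReal.ofReal_add (mul_nonneg (hw q).le measureReal_nonneg)
              (inv_nonneg.2 (hw q).le), ENNReal.ofReal_mul (hw q).le,
              ofReal_measureReal]
        _ = (∑' q, ENNReal.ofReal (latticeWeight q.1 * latticeWeight q.2) * μ (N ⁻¹' {q})) +
              ∑' q : (Fin D → ℤ) × (Fin D → ℤ),
                ENNReal.ofReal (latticeWeight q.1 * latticeWeight q.2)⁻¹ := ENNReal.tsum_add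
        _ ≤ _ := by
            gcongr
            calc ∑' q, ENNReal.ofReal (latticeWeight q.1 * latticeWeight q.2) * μ (N ⁻¹' {q})
                ≤ ∑' q, ∫⁻ ω in N ⁻¹' {q}, ENNReal.ofReal (Real.exp (2 * D)) *
                    ENNReal.ofReal (Real.exp (D * ‖X ω‖ + D * ‖W ω‖)) ∂μ := by
                  refine ENNReal.tsum_le_tsum fun q => ?_
                  rw [← setLIntegral_const]
                  refine setLIntegral_mono' (hA q) fun ω hω => ?_
                  rw [← ENNReal.ofReal_mul (Real.exp_pos _).le]
                  refine ENNReal.ofReal_le_ofReal ?_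
                  refine (mul_le_mul (latticeWeight_le (hAX q ω hω))
                    (latticeWeight_le (hAW q ω hω)) (latticeWeight_pos _).le (Real.exp_pos _).le).trans_eq ?_
                  rw [← Real.exp_add, ← Real.exp_add]
                  ring_nf
              _ = ∫⁻ ω, ENNReal.ofReal (Real.exp (2 * D)) *
                    ENNReal.ofReal (Real.exp (D * ‖X ω‖ + D * ‖W ω‖)) ∂μ := by
                  rw [← lintegral_iUnion hA
                    (fun q q' h => Disjoint.preimage _ (by simpa using h))]
                  have hU : ⋃ q, N ⁻¹' {q} = Set.univ := by ext; simp
                  rw [hU, setLIntegral_univ]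
              _ ≤ _ := by
                  rw [lintegral_const_mul' _ _ ENNReal.ofReal_ne_top,
                    ENNReal.ofReal_mul (Real.exp_pos _).le]
                  gcongr
    rw [lintegral_const_mul _ (Measurable.tsum hHm),
      lintegral_tsum fun q => (hHm q).aemeasurable]
    calc ENNReal.ofReal (n : ℝ)⁻¹ * ∑' q, ∫⁻ s, H q s ∂(Measure.pi fun _ => μ)
        ≤ ENNReal.ofReal (n : ℝ)⁻¹ * ∑' q, ENNReal.ofReal (C₁ * (n * ρ)) *
            ENNReal.ofReal (√(μ.real (N ⁻¹' {q}))) := by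
          gcongr with q
          refine (hHint q).trans_eq ?_
          rw [ENNReal.ofReal_mul (by positivity)]
      _ ≤ ENNReal.ofReal (n : ℝ)⁻¹ * (ENNReal.ofReal (C₁ * (n * ρ)) *
            ENNReal.ofReal (Real.exp (2 * D) * B + S)) := by
          rw [ENNReal.tsum_mul_left]
          gcongr
      _ = ENNReal.ofReal (C₁ * (Real.exp (2 * D) * B + S) * ρ) := by
          rw [← ENNReal.ofReal_mul (by positivity), ← ENNReal.ofReal_mul (by positivity)]
          congr 1
          field_simp

/-! ### Gaussian shifts and smoothing -/

lemma pi_withDensity {ι : Type*} [Fintype ι] {X : ι → Type*} [∀ i, MeasurableSpace (X i)]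
    (μ : ∀ i, Measure (X i)) [∀ i, IsProbabilityMeasure (μ i)] {ρ : ∀ i, X i → ℝ≥0∞}
    (hρ : ∀ i, Measurable (ρ i)) [∀ i, SigmaFinite ((μ i).withDensity (ρ i))] :
    Measure.pi (fun i => (μ i).withDensity (ρ i)) =
      (Measure.pi μ).withDensity fun x => ∏ i, ρ i (x i) := by
  -- It suffices to compare on boxes, where the indicator factors and independence of the
  -- coordinates splits the integral.
  refine Measure.pi_eq fun s hs => ?_
  rw [withDensity_apply _ (MeasurableSet.univ_pi hs), ← lintegral_indicator (MeasurableSet.univ_pi hs)]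
  have h1 : ∀ x : ∀ i, X i, (Set.univ.pi s).indicator (fun x => ∏ i, ρ i (x i)) x =
      ∏ i, (s i).indicator (ρ i) (x i) := fun x => by
    by_cases hx : x ∈ Set.univ.pi s
    · rw [Set.indicator_of_mem hx]
      exact Finset.prod_congr rfl fun i _ => (Set.indicator_of_mem (hx i trivial) _).symm
    · rw [Set.indicator_of_notMem hx]
      obtain ⟨i, hi⟩ : ∃ i, x i ∉ s i := by simpa [Set.mem_pi] using hx
      exact (Finset.prod_eq_zero (Finset.mem_univ i) (Set.indicator_of_notMem hi _)).symm
  have hm : ∀ i, Measurable ((s i).indicator (ρ i)) := fun i => (hρ i).indicator (hs i)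
  simp only [h1]
  rw [lintegral_prod_eq_prod_lintegral_of_indepFun Finset.univ
    (fun i (x : ∀ i, X i) => (s i).indicator (ρ i) (x i))
    (iIndepFun_pi fun i => (hm i).aemeasurable) fun i => (hm i).comp (measurable_pi_apply i)]
  refine Finset.prod_congr rfl fun i _ => ?_
  rw [withDensity_apply _ (hs i), ← lintegral_indicator (hs i)]
  exact (measurePreserving_eval μ i).lintegral_comp (hm i)

lemma gaussianReal_eq_withDensity (s : ℝ) :
    gaussianReal s 1 =
      (gaussianReal 0 1).withDensity fun t => ENNReal.ofReal (Real.exp (s * t - s ^ 2 / 2)) := by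
  rw [gaussianReal_of_var_ne_zero _ one_ne_zero, gaussianReal_of_var_ne_zero _ one_ne_zero,
    ← withDensity_mul _ (by fun_prop) (by fun_prop)]
  congr 1
  ext t
  simp only [gaussianPDF, Pi.mul_apply, gaussianPDFReal]
  rw [← ENNReal.ofReal_mul (by positivity), mul_assoc _ (Real.exp _) (Real.exp _), ← Real.exp_add]
  congr 3
  simp
  ring

lemma pi_gaussianReal_eq_withDensity {D : ℕ} (v : Fin D → ℝ) :
    Measure.pi (fun i => gaussianReal (v i) 1) =
      (Measure.pi fun _ : Fin D => gaussianReal 0 1).withDensity fun z =>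
        ENNReal.ofReal (Real.exp (∑ i, (v i * z i - v i ^ 2 / 2))) := by
  have h : ∀ i, SigmaFinite ((gaussianReal 0 1).withDensity
      fun t => ENNReal.ofReal (Real.exp (v i * t - v i ^ 2 / 2))) := fun i => by
    rw [← gaussianReal_eq_withDensity]; infer_instance
  rw [show (fun i => gaussianReal (v i) 1) = _ from
    funext fun i => gaussianReal_eq_withDensity (v i), pi_withDensity _ fun i => by fun_prop]
  congr 1
  ext z
  rw [Real.exp_sum, ENNReal.ofReal_prod_of_nonneg fun i _ => (Real.exp_pos _).le]

section Gaussian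

variable {D : ℕ}

local notation "E" => EuclideanSpace ℝ (Fin D)

/-- The Cameron–Martin formula for the standard Gaussian measure. -/
lemma stdGaussian_map_add_const (v : E) :
    (stdGaussian E).map (· + v) = (stdGaussian E).withDensity fun z =>
      ENNReal.ofReal (Real.exp (inner ℝ v z - ‖v‖ ^ 2 / 2)) := by
  have hL : Measurable (WithLp.toLp 2 : (Fin D → ℝ) → E) := by fun_prop
  ext s hs
  rw [Measure.map_apply (by fun_prop) hs, withDensity_apply _ hs, ← map_pi_eq_stdGaussian,
    Measure.map_apply hL ((by fun_prop : Measurable fun z : E => z + v) hs),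
    setLIntegral_map hs (by fun_prop) hL]
  have h1 : (Measure.pi fun _ : Fin D => gaussianReal 0 1).map (fun z i => z i + v i) =
      Measure.pi fun i => gaussianReal (v i) 1 := by
    rw [Measure.pi_map_pi (f := fun i t => t + v i) fun i => by fun_prop]
    simp only [gaussianReal_map_add_const, zero_add]
  have h2 := congrArg (fun m : Measure (Fin D → ℝ) => m (WithLp.toLp 2 ⁻¹' s))
    (h1.trans (pi_gaussianReal_eq_withDensity v))
  simp only at h2
  rw [Measure.map_apply (by fun_prop) (hL hs), withDensity_apply _ (hL hs)] at h2
  refine Eq.trans ?_ (h2.trans ?_)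
  · rfl
  · refine lintegral_congr fun z => ?_
    congr 2
    rw [Finset.sum_sub_distrib, EuclideanSpace.norm_sq_eq, Finset.sum_div]
    simp [PiLp.inner_apply, mul_comm]

/-- Fernique's theorem gives a square-exponential moment, and completing the square dominates the
linear exponent by it. -/
lemma integrable_exp_mul_norm_stdGaussian (c : ℝ) :
    Integrable (fun z => Real.exp (c * ‖z‖)) (stdGaussian E) := by
  obtain ⟨C, hC, hi⟩ := IsGaussian.exists_integrable_exp_sq (stdGaussian E)
  refine (hi.const_mul (Real.exp (c ^ 2 / (4 * C)))).mono' (by fun_prop) (ae_of_all _ fun z => ?_)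
  rw [Real.norm_eq_abs, Real.abs_exp, ← Real.exp_add]
  refine Real.exp_le_exp.2 ?_
  have h : c ^ 2 / (4 * C) + C * ‖z‖ ^ 2 - c * ‖z‖ = (2 * C * ‖z‖ - c) ^ 2 / (4 * C) := by
    field_simp; ring
  have : 0 ≤ (2 * C * ‖z‖ - c) ^ 2 / (4 * C) := by positivity
  linarith

lemma abs_exp_sub_one_le (y : ℝ) : |Real.exp y - 1| ≤ |y| * Real.exp |y| := by
  rw [abs_le]
  have h1 := Real.add_one_le_exp y
  have h2 := Real.add_one_le_exp (-y)
  have h3 : Real.exp y * Real.exp (-y) = 1 := by rw [← Real.exp_add]; simp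
  have h4 := Real.exp_pos y
  have h5 : 1 ≤ Real.exp |y| := Real.one_le_exp (abs_nonneg _)
  have h6 : Real.exp y ≤ Real.exp |y| := Real.exp_le_exp.2 (le_abs_self _)
  have h7 := le_abs_self y
  have h8 := neg_abs_le y
  constructor <;> nlinarith [abs_nonneg y]

/-- Convolution with the standard Gaussian measure maps bounded functions to Lipschitz
functions. -/
lemma exists_abs_integral_add_sub_le (D : ℕ) :
    ∃ G : ℝ, 0 ≤ G ∧ ∀ (h : EuclideanSpace ℝ (Fin D) → ℝ) (M : ℝ), Measurable h →
      (∀ z, |h z| ≤ M) → ∀ v,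
      |(∫ z, h (z + v) ∂(stdGaussian (EuclideanSpace ℝ (Fin D)))) -
        ∫ z, h z ∂(stdGaussian (EuclideanSpace ℝ (Fin D)))| ≤ G * M * ‖v‖ := by
  have hG : Integrable (fun z => Real.exp 2 * Real.exp (2 * ‖z‖))
      (stdGaussian (EuclideanSpace ℝ (Fin D))) :=
    (integrable_exp_mul_norm_stdGaussian 2).const_mul _
  set γ := stdGaussian (EuclideanSpace ℝ (Fin D)) with hγ
  set G := ∫ z, Real.exp 2 * Real.exp (2 * ‖z‖) ∂γ with hGdef
  have hG0 : 0 ≤ G := integral_nonneg fun z => by positivity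
  refine ⟨G + 2, by linarith, fun h M hh hM v => ?_⟩
  have hM0 : 0 ≤ M := (abs_nonneg _).trans (hM 0)
  -- For short `v` the Cameron–Martin density differs from `1` by `‖v‖` times an integrable
  -- function. For long `v` the trivial bound `2 * M` is at most `2 * M * ‖v‖`, whence the `+ 2` in
  -- the constant.
  rcases le_or_gt ‖v‖ 1 with hv | hv
  · have e1 : ∫ z, h (z + v) ∂γ = ∫ z, Real.exp (inner ℝ v z - ‖v‖ ^ 2 / 2) * h z ∂γ := by
      rw [← integral_map (φ := fun z => z + v) (f := h) (by fun_prop) hh.aestronglyMeasurable, hγ,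
        stdGaussian_map_add_const, integral_withDensity_eq_integral_toReal_smul (by fun_prop)
          (ae_of_all _ fun z => ENNReal.ofReal_lt_top)]
      refine integral_congr_ae (ae_of_all _ fun z => ?_)
      simp [ENNReal.toReal_ofReal (Real.exp_pos _).le]
    have key : ∀ z : EuclideanSpace ℝ (Fin D), |Real.exp (inner ℝ v z - ‖v‖ ^ 2 / 2) - 1| ≤
        ‖v‖ * (Real.exp 2 * Real.exp (2 * ‖z‖)) := fun z => by
      have h1 : |inner ℝ v z - ‖v‖ ^ 2 / 2| ≤ ‖v‖ * (‖z‖ + 1) := by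
        have := abs_real_inner_le_norm v z
        have h2 := abs_sub (inner ℝ v z) (‖v‖ ^ 2 / 2)
        rw [abs_of_nonneg (show 0 ≤ ‖v‖ ^ 2 / 2 by positivity)] at h2
        nlinarith [norm_nonneg v]
      have h3 : ‖v‖ * (‖z‖ + 1) ≤ ‖z‖ + 1 := mul_le_of_le_one_left (by positivity) hv
      have h4 : ‖z‖ + 1 ≤ Real.exp (‖z‖ + 1) := by
        have := Real.add_one_le_exp (‖z‖ + 1); linarith
      calc |Real.exp (inner ℝ v z - ‖v‖ ^ 2 / 2) - 1| ≤ _ := abs_exp_sub_one_le _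
        _ ≤ (‖v‖ * (‖z‖ + 1)) * Real.exp (‖z‖ + 1) :=
            mul_le_mul h1 (Real.exp_le_exp.2 (h1.trans h3)) (Real.exp_pos _).le (by positivity)
        _ ≤ (‖v‖ * Real.exp (‖z‖ + 1)) * Real.exp (‖z‖ + 1) := by gcongr
        _ = ‖v‖ * (Real.exp 2 * Real.exp (2 * ‖z‖)) := by
            rw [mul_assoc, ← Real.exp_add, ← Real.exp_add]; ring_nf
    have hi : Integrable h γ := integrable_of_abs_le hh hM
    have hi2 : Integrable (fun z => (Real.exp (inner ℝ v z - ‖v‖ ^ 2 / 2) - 1) * h z) γ := by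
      refine (hG.const_mul (‖v‖ * M)).mono' (by fun_prop) (ae_of_all _ fun z => ?_)
      rw [Real.norm_eq_abs, abs_mul]
      refine (mul_le_mul (key z) (hM z) (abs_nonneg _) (by positivity)).trans_eq (by ring)
    have e2 : (∫ z, h (z + v) ∂γ) - ∫ z, h z ∂γ =
        ∫ z, (Real.exp (inner ℝ v z - ‖v‖ ^ 2 / 2) - 1) * h z ∂γ := by
      have : ∀ z, Real.exp (inner ℝ v z - ‖v‖ ^ 2 / 2) * h z =
          (Real.exp (inner ℝ v z - ‖v‖ ^ 2 / 2) - 1) * h z + h z := fun z => by ring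
      rw [e1, integral_congr_ae (ae_of_all _ this), integral_add hi2 hi, add_sub_cancel_right]
    rw [e2]
    calc _ ≤ ∫ z, |(Real.exp (inner ℝ v z - ‖v‖ ^ 2 / 2) - 1) * h z| ∂γ :=
          abs_integral_le_integral_abs
      _ ≤ ∫ z, (‖v‖ * M) * (Real.exp 2 * Real.exp (2 * ‖z‖)) ∂γ := by
          refine integral_mono hi2.abs (hG.const_mul _) fun z => ?_
          show |(Real.exp (inner ℝ v z - ‖v‖ ^ 2 / 2) - 1) * h z| ≤ _
          rw [abs_mul]
          exact (mul_le_mul (key z) (hM z) (abs_nonneg _) (by positivity)).trans_eq (by ring)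
      _ = (‖v‖ * M) * G := by rw [integral_const_mul]
      _ ≤ (G + 2) * M * ‖v‖ := by nlinarith [mul_nonneg hM0 (norm_nonneg v)]
  · have b : ∀ u : EuclideanSpace ℝ (Fin D), |∫ z, h (z + u) ∂γ| ≤ M := fun u => by
      simpa using norm_integral_le_of_norm_le_const (μ := γ) (f := fun z => h (z + u)) (C := M)
        (ae_of_all _ fun z => hM _)
    have b0 := b 0
    simp only [add_zero] at b0
    have := abs_sub (∫ z, h (z + v) ∂γ) (∫ z, h z ∂γ)
    have := b v
    have h5 : M ≤ M * ‖v‖ := le_mul_of_one_le_right hM0 hv.le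
    nlinarith [mul_nonneg hM0 (norm_nonneg v)]

end Gaussian

/-! ### Bounded Lipschitz classes, extensions, and smoothed potentials -/

section LipBdd

variable {D : ℕ} {L L' : ℝ≥0} {M M' : ℝ} {S : Set (EuclideanSpace ℝ (Fin D))}

lemma LipBdd_mono (hL : L ≤ L') (hM : M ≤ M') : LipBdd L M S ⊆ LipBdd L' M' S :=
  fun _ hg => ⟨hg.1.weaken hL, fun x hx => (hg.2 x hx).trans hM⟩

lemma mem_LipBdd_univ {g : EuclideanSpace ℝ (Fin D) → ℝ} :
    g ∈ LipBdd L M Set.univ ↔ LipschitzWith L g ∧ ∀ x, |g x| ≤ M := by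
  simp [LipBdd, lipschitzOnWith_univ]

lemma one_mem_LipBdd : (fun _ => 1 : EuclideanSpace ℝ (Fin D) → ℝ) ∈ LipBdd 0 1 Set.univ :=
  mem_LipBdd_univ.2 ⟨LipschitzWith.const 1, fun _ => by simp⟩

lemma exp_sub_exp_le {u v : ℝ} (hu : u ≤ M) : Real.exp u - Real.exp v ≤ Real.exp M * |u - v| := by
  have h1 := Real.add_one_le_exp (v - u)
  have h2 : Real.exp v = Real.exp u * Real.exp (v - u) := by rw [← Real.exp_add]; ring_nf
  have h3 := Real.exp_le_exp.2 hu
  have h4 := Real.exp_pos u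
  calc Real.exp u - Real.exp v ≤ Real.exp u * (u - v) := by rw [h2]; nlinarith
    _ ≤ Real.exp u * |u - v| := by gcongr; exact le_abs_self _
    _ ≤ Real.exp M * |u - v| := by gcongr

lemma exp_comp_mem_LipBdd {g : EuclideanSpace ℝ (Fin D) → ℝ} (hg : g ∈ LipBdd L M Set.univ) :
    (fun x => Real.exp (g x)) ∈ LipBdd ((Real.exp M).toNNReal * L) (Real.exp M) Set.univ := by
  obtain ⟨h1, h2⟩ := mem_LipBdd_univ.1 hg
  refine mem_LipBdd_univ.2 ⟨LipschitzWith.of_dist_le_mul fun x y => ?_, fun x => ?_⟩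
  · rw [Real.dist_eq, NNReal.coe_mul, Real.coe_toNNReal _ (Real.exp_pos M).le, mul_assoc]
    refine le_trans ?_ (mul_le_mul_of_nonneg_left (h1.dist_le_mul x y) (Real.exp_pos M).le)
    rw [Real.dist_eq]
    refine abs_sub_le_iff.2 ⟨exp_sub_exp_le ((le_abs_self _).trans (h2 x)), ?_⟩
    rw [abs_sub_comm]
    exact exp_sub_exp_le ((le_abs_self _).trans (h2 y))
  · rw [Real.abs_exp]
    exact Real.exp_le_exp.2 ((le_abs_self _).trans (h2 x))

lemma const_mul_mem_LipBdd {g : EuclideanSpace ℝ (Fin D) → ℝ} (hg : g ∈ LipBdd L M Set.univ)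
    (c : ℝ) : (fun x => c * g x) ∈ LipBdd (|c|.toNNReal * L) (|c| * M) Set.univ := by
  obtain ⟨h1, h2⟩ := mem_LipBdd_univ.1 hg
  refine mem_LipBdd_univ.2 ⟨LipschitzWith.of_dist_le_mul fun x y => ?_, fun x => ?_⟩
  · rw [Real.dist_eq, NNReal.coe_mul, Real.coe_toNNReal _ (abs_nonneg c), ← mul_sub, abs_mul,
      mul_assoc, ← Real.dist_eq]
    exact mul_le_mul_of_nonneg_left (h1.dist_le_mul x y) (abs_nonneg c)
  · rw [abs_mul]
    exact mul_le_mul_of_nonneg_left (h2 x) (abs_nonneg c)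

lemma comp_add_const_mem_LipBdd {g : EuclideanSpace ℝ (Fin D) → ℝ}
    (hg : g ∈ LipBdd L M Set.univ) (c : EuclideanSpace ℝ (Fin D)) :
    (fun x => g (x + c)) ∈ LipBdd L M Set.univ := by
  obtain ⟨h1, h2⟩ := mem_LipBdd_univ.1 hg
  refine mem_LipBdd_univ.2 ⟨LipschitzWith.of_dist_le_mul fun x y => ?_, fun x => h2 _⟩
  simpa using h1.dist_le_mul (x + c) (y + c)

/-- Functions that are Lipschitz and bounded on a set extend to the whole space. -/
lemma exists_extension (hM : 0 ≤ M) {f : EuclideanSpace ℝ (Fin D) → ℝ} (hf : f ∈ LipBdd L M S) :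
    ∃ g ∈ LipBdd L M Set.univ, Set.EqOn f g S := by
  obtain ⟨g, hg, hfg⟩ := hf.1.extend_real
  -- Truncating the Lipschitz extension at `±M` keeps the Lipschitz constant and changes nothing on
  -- `S`.
  refine ⟨fun x => max (-M) (min M (g x)), mem_LipBdd_univ.2 ⟨?_, fun x => ?_⟩, fun x hx => ?_⟩
  · exact (hg.const_min M).const_max (-M)
  · exact abs_le.2 ⟨le_max_left _ _, max_le (by linarith) (min_le_left _ _)⟩
  · have := abs_le.1 (hf.2 x hx)
    show f x = max (-M) (min M (g x))
    rw [← hfg hx, min_eq_right this.2, max_eq_right this.1]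

/-- One extension is fixed for each function, so that a supremum over a class can be rewritten term
by term. -/
lemma exists_extension_map (hM : 0 ≤ M) (L : ℝ≥0) (S : Set (EuclideanSpace ℝ (Fin D))) :
    ∃ e : (EuclideanSpace ℝ (Fin D) → ℝ) → EuclideanSpace ℝ (Fin D) → ℝ,
      ∀ f ∈ LipBdd L M S, e f ∈ LipBdd L M Set.univ ∧ Set.EqOn f (e f) S := by
  classical
  refine ⟨fun f => if hf : f ∈ LipBdd L M S then (exists_extension hM hf).choose else f,
    fun f hf => ?_⟩
  simp only [hf, dif_pos]
  exact (exists_extension hM hf).choose_spec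

end LipBdd

/-- The Gaussian smoothing `x ↦ E exp (f (x + √ε z) / ε)`. -/
noncomputable def gaussSmooth {D : ℕ} (ε : ℝ) (f : EuclideanSpace ℝ (Fin D) → ℝ)
    (x : EuclideanSpace ℝ (Fin D)) : ℝ :=
  ∫ z, Real.exp (f (x + √ε • z) / ε) ∂(stdGaussian (EuclideanSpace ℝ (Fin D)))

lemma expTerm_eq {D : ℕ} (ε : ℝ) (f ξ : EuclideanSpace ℝ (Fin D) → ℝ)
    (x : EuclideanSpace ℝ (Fin D)) :
    expTerm ε f ξ x = Real.exp (-ξ x) * gaussSmooth ε f x := by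
  rw [expTerm, gaussSmooth, ← integral_const_mul]
  refine integral_congr_ae (ae_of_all _ fun z => ?_)
  simp only
  rw [← Real.exp_add]
  ring_nf

/-- Moving `x` by `h` translates the noise by `h / √ε`, so the regularity comes from the Gaussian
and `f` need not be continuous. -/
lemma exists_gaussSmooth_mem_LipBdd (D : ℕ) {ε : ℝ} (hε : 0 < ε) (M : ℝ) :
    ∃ L : ℝ≥0, ∀ f : EuclideanSpace ℝ (Fin D) → ℝ, Measurable f → (∀ x, |f x| ≤ M) →
      gaussSmooth ε f ∈ LipBdd L (Real.exp (M / ε)) Set.univ := by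
  obtain ⟨G, hG, h⟩ := exists_abs_integral_add_sub_le D
  have hs : 0 < √ε := Real.sqrt_pos.2 hε
  have hc : 0 ≤ G * Real.exp (M / ε) * (√ε)⁻¹ := by positivity
  refine ⟨(G * Real.exp (M / ε) * (√ε)⁻¹).toNNReal, fun f hf hM => ?_⟩
  have hb : ∀ x, |Real.exp (f x / ε)| ≤ Real.exp (M / ε) := fun x => by
    rw [Real.abs_exp]
    exact Real.exp_le_exp.2 (div_le_div_of_nonneg_right ((le_abs_self _).trans (hM x)) hε.le)
  refine mem_LipBdd_univ.2 ⟨LipschitzWith.of_dist_le_mul fun x y => ?_, fun x => ?_⟩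
  · have := h (fun z => Real.exp (f (y + √ε • z) / ε)) _ (by fun_prop) (fun z => hb _)
      ((√ε)⁻¹ • (x - y))
    have e : ∀ z, y + √ε • (z + (√ε)⁻¹ • (x - y)) = x + √ε • z := fun z => by
      rw [smul_add, smul_inv_smul₀ hs.ne']; abel
    simp only [e] at this
    rw [Real.dist_eq, Real.coe_toNNReal _ hc, dist_eq_norm]
    refine this.trans_eq ?_
    rw [norm_smul, norm_inv, Real.norm_of_nonneg hs.le]
    ring
  · simpa [gaussSmooth] using norm_integral_le_of_norm_le_const
      (μ := stdGaussian (EuclideanSpace ℝ (Fin D)))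
      (f := fun z => Real.exp (f (x + √ε • z) / ε)) (C := Real.exp (M / ε))
      (ae_of_all _ fun z => hb _)

/-! ### Deviation bounds for the two sampling laws -/

/-- Uniform deviation bound over products of Lipschitz functions for a compactly supported law. -/
lemma exists_compact_deviation_bound (D : ℕ) (L : ℝ≥0) {M d : ℝ} (hM : 0 ≤ M) :
    ∃ C : ℝ, 0 ≤ C ∧ ∀ (p : Measure (EuclideanSpace ℝ (Fin D))) [IsProbabilityMeasure p]
      (n : ℕ), 0 < n → IsCompact p.support → Metric.diam p.support ≤ d →
      ∃ H : (Fin n → EuclideanSpace ℝ (Fin D)) → ℝ≥0∞, Measurable H ∧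
        (∀ a ∈ LipBdd L M Set.univ, ∀ b ∈ LipBdd L M Set.univ, ∀ s,
          ENNReal.ofReal |(∫ x, a x * b x ∂p) - 1 / (n : ℝ) * ∑ i, a (s i) * b (s i)| ≤ H s) ∧
        ∫⁻ s, H s ∂(Measure.pi fun _ => p) ≤
          ENNReal.ofReal (C * (n : ℝ) ^ (-(1 / (1 + (D : ℝ))))) := by
  obtain ⟨C, hC, h⟩ := exists_lipschitz_mul_deviation_bound D L hM
    (B := Real.exp (D * d + D * d)) (Real.exp_pos _).le
  refine ⟨C, hC, fun p _ n hn hp hd => ?_⟩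
  -- Recentering at a point of the support makes the moment depend on the diameter only; the
  -- Lipschitz classes are translation invariant.
  obtain ⟨c, hc⟩ := p.nonempty_support (IsProbabilityMeasure.ne_zero p)
  have hmom : ∫⁻ x, ENNReal.ofReal (Real.exp (D * ‖x - c‖ + D * ‖x - c‖)) ∂p ≤
      ENNReal.ofReal (Real.exp (D * d + D * d)) := by
    refine (lintegral_mono_ae (g := fun _ => ENNReal.ofReal (Real.exp (D * d + D * d))) ?_).trans
      (by simp)
    filter_upwards [Measure.support_mem_ae (μ := p)] with x hx
    have h1 : ‖x - c‖ ≤ d := by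
      rw [← dist_eq_norm]
      exact (Metric.dist_le_diam_of_mem hp.isBounded hx hc).trans hd
    gcongr
  obtain ⟨H, hH, hs, hint⟩ := h _ p (fun x => x - c) (fun x => x - c) n hn (by fun_prop)
    (by fun_prop) hmom
  refine ⟨H, hH, fun a ha b hb s => ?_, hint⟩
  have ha' := mem_LipBdd_univ.1 (comp_add_const_mem_LipBdd ha c)
  have hb' := mem_LipBdd_univ.1 (comp_add_const_mem_LipBdd hb c)
  simpa only [sub_add_cancel] using hs _ _ ha'.1 hb'.1 ha'.2 hb'.2 s

/-- Uniform deviation bound over products of a Lipschitz function of `x` and a Lipschitz function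
of `x + √ε z`, with `x` compactly supported and `z` standard Gaussian. -/
lemma exists_gaussian_deviation_bound (D : ℕ) (L : ℝ≥0) (ε : ℝ) {M d : ℝ} (hM : 0 ≤ M) :
    ∃ C : ℝ, 0 ≤ C ∧ ∀ (p : Measure (EuclideanSpace ℝ (Fin D))) [IsProbabilityMeasure p]
      (n : ℕ), 0 < n → IsCompact p.support → Metric.diam p.support ≤ d →
      ∃ H : (Fin n → EuclideanSpace ℝ (Fin D) × EuclideanSpace ℝ (Fin D)) → ℝ≥0∞,
        Measurable H ∧
        (∀ a ∈ LipBdd L M Set.univ, ∀ b ∈ LipBdd L M Set.univ, ∀ s,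
          ENNReal.ofReal |(∫ ω, a ω.1 * b (ω.1 + √ε • ω.2)
              ∂(p.prod (stdGaussian (EuclideanSpace ℝ (Fin D))))) -
            1 / (n : ℝ) * ∑ i, a (s i).1 * b ((s i).1 + √ε • (s i).2)| ≤ H s) ∧
        ∫⁻ s, H s ∂(Measure.pi fun _ => p.prod (stdGaussian (EuclideanSpace ℝ (Fin D)))) ≤
          ENNReal.ofReal (C * (n : ℝ) ^ (-(1 / (1 + (D : ℝ))))) := by
  set γ := stdGaussian (EuclideanSpace ℝ (Fin D)) with hγ
  -- After recentering, this dominates the moment integrand: both norms are at most `d`, up to `√ε *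
  -- ‖z‖` in the second.
  have hi : Integrable (fun z => Real.exp (D * d + D * d) * Real.exp (D * √ε * ‖z‖)) γ :=
    (integrable_exp_mul_norm_stdGaussian _).const_mul _
  obtain ⟨C, hC, h⟩ := exists_lipschitz_mul_deviation_bound D L hM
    (B := ∫ z, Real.exp (D * d + D * d) * Real.exp (D * √ε * ‖z‖) ∂γ)
    (integral_nonneg fun z => by positivity)
  refine ⟨C, hC, fun p _ n hn hp hd => ?_⟩
  obtain ⟨c, hc⟩ := p.nonempty_support (IsProbabilityMeasure.ne_zero p)
  have hmom : ∫⁻ ω, ENNReal.ofReal (Real.exp (D * ‖ω.1 - c‖ + D * ‖ω.1 + √ε • ω.2 - c‖))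
      ∂(p.prod γ) ≤
      ENNReal.ofReal (∫ z, Real.exp (D * d + D * d) * Real.exp (D * √ε * ‖z‖) ∂γ) := by
    rw [lintegral_prod _ (by fun_prop)]
    refine (lintegral_mono_ae (g := fun _ => ENNReal.ofReal
      (∫ z, Real.exp (D * d + D * d) * Real.exp (D * √ε * ‖z‖) ∂γ)) ?_).trans (by simp)
    filter_upwards [Measure.support_mem_ae (μ := p)] with x hx
    have h1 : ‖x - c‖ ≤ d := by
      rw [← dist_eq_norm]
      exact (Metric.dist_le_diam_of_mem hp.isBounded hx hc).trans hd
    rw [ofReal_integral_eq_lintegral_ofReal hi (ae_of_all _ fun z => by positivity)]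
    refine lintegral_mono fun z => ENNReal.ofReal_le_ofReal ?_
    rw [← Real.exp_add]
    refine Real.exp_le_exp.2 ?_
    have h2 : ‖x + √ε • z - c‖ ≤ d + √ε * ‖z‖ := by
      rw [add_sub_right_comm]
      refine (norm_add_le _ _).trans (add_le_add h1 ?_)
      rw [norm_smul, Real.norm_of_nonneg (Real.sqrt_nonneg _)]
    have h3 := mul_le_mul_of_nonneg_left h1 (Nat.cast_nonneg (α := ℝ) D)
    have h4 := mul_le_mul_of_nonneg_left h2 (Nat.cast_nonneg (α := ℝ) D)
    linarith
  obtain ⟨H, hH, hs, hint⟩ := h _ (p.prod γ) (fun ω => ω.1 - c) (fun ω => ω.1 + √ε • ω.2 - c) n hn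
    (by fun_prop) (by fun_prop) hmom
  refine ⟨H, hH, fun a ha b hb s => ?_, hint⟩
  have ha' := mem_LipBdd_univ.1 (comp_add_const_mem_LipBdd ha c)
  have hb' := mem_LipBdd_univ.1 (comp_add_const_mem_LipBdd hb c)
  simpa only [sub_add_cancel] using hs _ _ ha'.1 hb'.1 ha'.2 hb'.2 s

/-! ### Decomposition of the loss and the main theorem -/

section Main

variable {D N M K : ℕ} {ε : ℝ} {p₀ p₁ : Measure (EuclideanSpace ℝ (Fin D))}
  [IsProbabilityMeasure p₀] [IsProbabilityMeasure p₁]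

instance : IsProbabilityMeasure (dataLaw p₀ p₁ N M) := by
  unfold dataLaw; infer_instance

instance : IsProbabilityMeasure (noiseLaw D N K) := by
  unfold noiseLaw; infer_instance

lemma ae_dataLaw_mem_support :
    ∀ᵐ s ∂(dataLaw p₀ p₁ N M), (∀ i, s.1 i ∈ p₀.support) ∧ ∀ j, s.2 j ∈ p₁.support := by
  have h0 : ∀ᵐ x ∂(Measure.pi fun _ : Fin N => p₀), ∀ i, x i ∈ p₀.support :=
    ae_all_iff.2 fun i => (Measure.quasiMeasurePreserving_eval (fun _ => p₀) i).ae
      Measure.support_mem_ae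
  have h1 : ∀ᵐ y ∂(Measure.pi fun _ : Fin M => p₁), ∀ j, y j ∈ p₁.support :=
    ae_all_iff.2 fun j => (Measure.quasiMeasurePreserving_eval (fun _ => p₁) j).ae
      Measure.support_mem_ae
  exact (Measure.quasiMeasurePreserving_fst.ae h0).and (Measure.quasiMeasurePreserving_snd.ae h1)

omit [IsProbabilityMeasure p₀] in
lemma integral_congr_of_eqOn_support {f g : EuclideanSpace ℝ (Fin D) → ℝ}
    (h : Set.EqOn f g p₀.support) : ∫ x, f x ∂p₀ = ∫ x, g x ∂p₀ := by
  refine integral_congr_ae ?_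
  filter_upwards [Measure.support_mem_ae (μ := p₀)] with x hx using h hx

lemma expTerm_eqOn {S : Set (EuclideanSpace ℝ (Fin D))} {f ξ ξ' : EuclideanSpace ℝ (Fin D) → ℝ}
    (h : Set.EqOn ξ ξ' S) : Set.EqOn (expTerm ε f ξ) (expTerm ε f ξ') S := fun x hx => by
  rw [expTerm_eq, expTerm_eq, h hx]

/-- The noise sample with index `k`, paired with the data, is an i.i.d. sample. -/
lemma measurePreserving_data_noise (k : Fin K) :
    MeasurePreserving
      (fun s : ((Fin N → EuclideanSpace ℝ (Fin D)) × (Fin M → EuclideanSpace ℝ (Fin D))) ×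
        (Fin N → Fin K → EuclideanSpace ℝ (Fin D)) => fun i => (s.1.1 i, s.2 i k))
      ((dataLaw p₀ p₁ N M).prod (noiseLaw D N K))
      (Measure.pi fun _ => p₀.prod (stdGaussian (EuclideanSpace ℝ (Fin D)))) := by
  have h1 : MeasurePreserving Prod.fst (dataLaw p₀ p₁ N M) (Measure.pi fun _ => p₀) :=
    measurePreserving_fst
  have h2 : MeasurePreserving (fun (z : Fin N → Fin K → EuclideanSpace ℝ (Fin D)) i => z i k)
      (noiseLaw D N K) (Measure.pi fun _ => stdGaussian (EuclideanSpace ℝ (Fin D))) :=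
    measurePreserving_pi _ _ fun _ => measurePreserving_eval _ k
  have h3 := (measurePreserving_arrowProdEquivProdArrow (EuclideanSpace ℝ (Fin D))
    (EuclideanSpace ℝ (Fin D)) (Fin N) (fun _ => p₀)
    (fun _ => stdGaussian (EuclideanSpace ℝ (Fin D)))).symm
  exact h3.comp (h1.prod h2)

omit [IsProbabilityMeasure p₁] in
-- By Fubini the double expectation is an integral over `p₀ ⊗ N(0, I)`, and the mean over `k` is
-- pulled outside. The factors `1` put the linear terms into the product form of the deviation
-- bounds.
lemma loss_sub_empLoss (hK : 0 < K) (hε : 0 < ε) {L L' : ℝ≥0} {A A' : ℝ}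
    {f ξ ξ' : EuclideanSpace ℝ (Fin D) → ℝ} (hf : f ∈ LipBdd L A Set.univ)
    (hξ' : ξ' ∈ LipBdd L' A' Set.univ) (h : Set.EqOn ξ ξ' p₀.support)
    {x : Fin N → EuclideanSpace ℝ (Fin D)} (hx : ∀ i, x i ∈ p₀.support)
    (y : Fin M → EuclideanSpace ℝ (Fin D)) (z : Fin N → Fin K → EuclideanSpace ℝ (Fin D)) :
    loss ε p₀ p₁ f ξ - empLoss ε x y z f ξ =
      ((∫ y, f y * 1 ∂p₁) - 1 / (M : ℝ) * ∑ j, f (y j) * 1) -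
        ε * ((∫ x, ξ' x * 1 ∂p₀) - 1 / (N : ℝ) * ∑ i, ξ' (x i) * 1) -
        ε * (1 / (K : ℝ) * ∑ k, ((∫ ω, Real.exp (-1 * ξ' ω.1) *
            Real.exp (ε⁻¹ * f (ω.1 + √ε • ω.2))
              ∂(p₀.prod (stdGaussian (EuclideanSpace ℝ (Fin D))))) -
          1 / (N : ℝ) * ∑ i, Real.exp (-1 * ξ' (x i)) *
            Real.exp (ε⁻¹ * f (x i + √ε • z i k)))) := by
  obtain ⟨hξL, hξA⟩ := mem_LipBdd_univ.1 hξ'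
  obtain ⟨hfL, hfA⟩ := mem_LipBdd_univ.1 hf
  have hξm := hξL.continuous
  have hfm := hfL.continuous
  have e1 : ∫ x, expTerm ε f ξ x ∂p₀ = ∫ ω, Real.exp (-1 * ξ' ω.1) *
      Real.exp (ε⁻¹ * f (ω.1 + √ε • ω.2))
        ∂(p₀.prod (stdGaussian (EuclideanSpace ℝ (Fin D)))) := by
    rw [integral_congr_of_eqOn_support (expTerm_eqOn h), integral_prod]
    · refine integral_congr_ae (ae_of_all _ fun x => ?_)
      simp only [expTerm]
      refine integral_congr_ae (ae_of_all _ fun z => ?_)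
      simp only
      rw [← Real.exp_add]
      ring_nf
    · refine integrable_of_abs_le (by fun_prop) (c := Real.exp (A' + ε⁻¹ * A)) fun ω => ?_
      rw [← Real.exp_add, Real.abs_exp]
      refine Real.exp_le_exp.2 (add_le_add ?_ ?_)
      · have := (abs_le.1 (hξA ω.1)).1; linarith
      · exact mul_le_mul_of_nonneg_left ((le_abs_self _).trans (hfA _)) (inv_pos.2 hε).le
  have e2 : ∀ i k, Real.exp (f (x i + √ε • z i k) / ε - ξ' (x i)) =
      Real.exp (-1 * ξ' (x i)) * Real.exp (ε⁻¹ * f (x i + √ε • z i k)) := fun i k => by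
    rw [← Real.exp_add]; ring_nf
  have e3 : ∀ i, ξ (x i) = ξ' (x i) := fun i => h (hx i)
  have e4 : ∀ (I : ℝ) (T : Fin N → Fin K → ℝ), ∑ k, (I - 1 / (N : ℝ) * ∑ i, T i k) =
      K * I - 1 / (N : ℝ) * ∑ i, ∑ k, T i k := fun I T => by
    rw [Finset.sum_comm, Finset.sum_sub_distrib, ← Finset.mul_sum]
    simp
  have hK0 : (K : ℝ) ≠ 0 := by exact_mod_cast hK.ne'
  rw [loss, empLoss, e1, integral_congr_of_eqOn_support h, e4]
  simp only [e2, e3, mul_one]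
  generalize ∑ i, ∑ k, Real.exp (-1 * ξ' (x i)) * Real.exp (ε⁻¹ * f (x i + √ε • z i k)) = T
  generalize ∫ ω, Real.exp (-1 * ξ' ω.1) * Real.exp (ε⁻¹ * f (ω.1 + √ε • ω.2))
    ∂(p₀.prod (stdGaussian (EuclideanSpace ℝ (Fin D)))) = I
  field_simp
  ring

omit [IsProbabilityMeasure p₀] [IsProbabilityMeasure p₁] in
-- The smoothing keeps the original `f`: it sees all of `ℝᴰ`, where `f'` need not agree with `f`.
lemma loss_sub_empLossExact {f f' ξ ξ' : EuclideanSpace ℝ (Fin D) → ℝ}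
    (hf : Set.EqOn f f' p₁.support) (h : Set.EqOn ξ ξ' p₀.support)
    {x : Fin N → EuclideanSpace ℝ (Fin D)} (hx : ∀ i, x i ∈ p₀.support)
    {y : Fin M → EuclideanSpace ℝ (Fin D)} (hy : ∀ j, y j ∈ p₁.support) :
    loss ε p₀ p₁ f ξ - empLossExact ε x y f ξ =
      ((∫ y, f' y * 1 ∂p₁) - 1 / (M : ℝ) * ∑ j, f' (y j) * 1) -
        ε * ((∫ x, ξ' x * 1 ∂p₀) - 1 / (N : ℝ) * ∑ i, ξ' (x i) * 1) -
        ε * ((∫ x, Real.exp (-1 * ξ' x) * gaussSmooth ε f x ∂p₀) -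
          1 / (N : ℝ) * ∑ i, Real.exp (-1 * ξ' (x i)) * gaussSmooth ε f (x i)) := by
  have e1 : ∀ i, ξ (x i) = ξ' (x i) := fun i => h (hx i)
  have e2 : ∀ j, f (y j) = f' (y j) := fun j => hf (hy j)
  rw [loss, empLossExact, integral_congr_of_eqOn_support h, integral_congr_of_eqOn_support hf,
    integral_congr_of_eqOn_support (expTerm_eqOn h)]
  simp only [expTerm_eq, e1, e2, mul_one, neg_one_mul]
  ring

lemma ofReal_abs_sub_sub_le (hε : 0 ≤ ε) (a b c : ℝ) :
    ENNReal.ofReal |a - ε * b - ε * c| ≤ ENNReal.ofReal |a| +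
      ENNReal.ofReal ε * ENNReal.ofReal |b| + ENNReal.ofReal ε * ENNReal.ofReal |c| := by
  rw [← ENNReal.ofReal_mul hε, ← ENNReal.ofReal_mul hε,
    ← ENNReal.ofReal_add (by positivity) (by positivity),
    ← ENNReal.ofReal_add (by positivity) (by positivity)]
  refine ENNReal.ofReal_le_ofReal ((abs_sub _ _).trans ?_)
  have := abs_sub a (ε * b)
  rw [abs_mul, abs_of_nonneg hε] at this ⊢
  linarith

/-- An arbitrary, possibly uncountable, supremum of continuous functions is lower semicontinuous. -/
lemma measurable_biSup_ofReal_abs_sub {S : Type*} [TopologicalSpace S] [MeasurableSpace S]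
    [OpensMeasurableSpace S] {α β : Type*} {F : Set α} {G : Set β} {c : α → β → ℝ}
    {φ : α → β → S → ℝ} (hφ : ∀ f ∈ F, ∀ g ∈ G, Continuous (φ f g)) :
    Measurable fun s => ⨆ f ∈ F, ⨆ g ∈ G, ENNReal.ofReal |c f g - φ f g s| := by
  refine LowerSemicontinuous.measurable ?_
  refine lowerSemicontinuous_biSup fun f hf => lowerSemicontinuous_biSup fun g hg => ?_
  have := hφ f hf g hg
  exact (ENNReal.continuous_ofReal.comp (by fun_prop)).lowerSemicontinuous

lemma lintegral_add_const_mul_add_const_mul {S : Type*} [MeasurableSpace S] {μ : Measure S}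
    {f g h : S → ℝ≥0∞} (hf : Measurable f) (hg : Measurable g) (hh : Measurable h) (c d : ℝ≥0∞) :
    ∫⁻ s, (f s + c * g s + d * h s) ∂μ = (∫⁻ s, f s ∂μ) + c * (∫⁻ s, g s ∂μ) + d * ∫⁻ s, h s ∂μ := by
  rw [lintegral_add_right _ (hh.const_mul d), lintegral_add_left hf, lintegral_const_mul _ hg,
    lintegral_const_mul _ hh]

end Main

end VarEOT

open VarEOT in
theorem mainTheorem4 (D : ℕ) (ε : ℝ) (hε : 0 < ε) (Lf Lξ : ℝ≥0) (Mf Mξ d₀ d₁ : ℝ) :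
    ∃ C₀ C₁ : ℝ, ∀ p₀ p₁ : Measure (EuclideanSpace ℝ (Fin D)),
      IsProbabilityMeasure p₀ → IsProbabilityMeasure p₁ →
      IsCompact p₀.support → IsCompact p₁.support →
      Metric.diam p₀.support ≤ d₀ → Metric.diam p₁.support ≤ d₁ →
      ∀ F Ξ : Set (EuclideanSpace ℝ (Fin D) → ℝ), Ξ ⊆ VarEOT.LipBdd Lξ Mξ p₀.support →
      -- the empirical loss with `K` noise samples per data point
      (F ⊆ VarEOT.LipBdd Lf Mf Set.univ →
        ∀ N M K : ℕ, 0 < N → 0 < M → 0 < K →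
          AEMeasurable (VarEOT.supDev ε p₀ p₁ F Ξ N M K)
            ((VarEOT.dataLaw p₀ p₁ N M).prod (VarEOT.noiseLaw D N K)) ∧
          ∫⁻ s, VarEOT.supDev ε p₀ p₁ F Ξ N M K s
              ∂((VarEOT.dataLaw p₀ p₁ N M).prod (VarEOT.noiseLaw D N K)) ≤
            ENNReal.ofReal (C₀ * (N : ℝ) ^ (-(1 / (1 + (D : ℝ)))) +
              C₁ * (M : ℝ) ^ (-(1 / (1 + (D : ℝ)))))) ∧
      -- the empirical loss with exact inner expectation
      (F ⊆ VarEOT.LipBdd Lf Mf p₁.support → (∀ f ∈ F, Measurable f ∧ ∀ w, |f w| ≤ Mf) →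
        ∀ N M : ℕ, 0 < N → 0 < M →
          AEMeasurable (VarEOT.supDevExact ε p₀ p₁ F Ξ N M) (VarEOT.dataLaw p₀ p₁ N M) ∧
          ∫⁻ s, VarEOT.supDevExact ε p₀ p₁ F Ξ N M s ∂(VarEOT.dataLaw p₀ p₁ N M) ≤
            ENNReal.ofReal (C₀ * (N : ℝ) ^ (-(1 / (1 + (D : ℝ)))) +
              C₁ * (M : ℝ) ^ (-(1 / (1 + (D : ℝ)))))) := by
  -- Absolute values are used throughout because `Mf` and `Mξ` are arbitrary reals.
  obtain ⟨Lg, hLg⟩ := exists_gaussSmooth_mem_LipBdd D hε |Mf|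
  -- common Lipschitz constant and bound for all classes of functions involved
  set La : ℝ≥0 := (Real.exp (|(-1 : ℝ)| * |Mξ|)).toNNReal * (|(-1 : ℝ)|.toNNReal * Lξ) with hLa
  set Lb : ℝ≥0 := (Real.exp (|ε⁻¹| * |Mf|)).toNNReal * (|ε⁻¹|.toNNReal * Lf) with hLb
  set L : ℝ≥0 := Lf + Lξ + La + Lb + Lg with hL
  set B : ℝ := 1 + |Mf| + |Mξ| + Real.exp (|(-1 : ℝ)| * |Mξ|) + Real.exp (|ε⁻¹| * |Mf|) +
    Real.exp (|Mf| / ε) with hB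
  have hMf := abs_nonneg Mf
  have hMξ := abs_nonneg Mξ
  have hEa := Real.exp_pos (|(-1 : ℝ)| * |Mξ|)
  have hEb := Real.exp_pos (|ε⁻¹| * |Mf|)
  have hEg := Real.exp_pos (|Mf| / ε)
  have hB0 : 0 ≤ B := by linarith
  have hL1 : Lf ≤ L := by
    rw [hL, add_assoc, add_assoc, add_assoc]; exact le_self_add
  have hL2 : Lξ ≤ L := by
    rw [hL, add_comm Lf, add_assoc, add_assoc, add_assoc]; exact le_self_add
  have hL3 : La ≤ L := by
    rw [hL, add_comm (Lf + Lξ), add_assoc, add_assoc]; exact le_self_add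
  have hL4 : Lb ≤ L := by
    rw [hL, add_comm (Lf + Lξ + La), add_assoc]; exact le_self_add
  have hL5 : Lg ≤ L := le_add_self
  obtain ⟨CS₀, hCS₀, hS₀⟩ := exists_compact_deviation_bound D L (d := d₀) hB0
  obtain ⟨CS₁, hCS₁, hS₁⟩ := exists_compact_deviation_bound D L (d := d₁) hB0
  obtain ⟨CG, hCG, hG⟩ := exists_gaussian_deviation_bound D L ε (d := d₀) hB0
  have one_mem : (fun _ => 1 : EuclideanSpace ℝ (Fin D) → ℝ) ∈ LipBdd L B Set.univ :=
    LipBdd_mono zero_le (by linarith) one_mem_LipBdd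
  -- One pair of constants for both parts: part (1) costs `ε * CS₀ + ε * CG` in `N`, part (2) costs
  -- `2 * ε * CS₀`.
  refine ⟨2 * ε * CS₀ + ε * CG, CS₁, ?_⟩
  intro p₀ p₁ _ _ hp₀ hp₁ hd₀ hd₁ F Ξ hΞ
  obtain ⟨ext₀, hext₀⟩ := exists_extension_map hMξ Lξ p₀.support
  have hξext : ∀ ξ ∈ Ξ, ext₀ ξ ∈ LipBdd Lξ |Mξ| Set.univ ∧ Set.EqOn ξ (ext₀ ξ) p₀.support :=
    fun ξ hξ => hext₀ ξ (LipBdd_mono le_rfl (le_abs_self _) (hΞ hξ))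
  have ha : ∀ ξ ∈ Ξ, (fun x => Real.exp (-1 * ext₀ ξ x)) ∈ LipBdd L B Set.univ := fun ξ hξ =>
    LipBdd_mono hL3 (by linarith) (exp_comp_mem_LipBdd (const_mul_mem_LipBdd (hξext ξ hξ).1 (-1)))
  have hξB : ∀ ξ ∈ Ξ, ext₀ ξ ∈ LipBdd L B Set.univ := fun ξ hξ =>
    LipBdd_mono hL2 (by linarith) (hξext ξ hξ).1
  refine ⟨fun hF N M K hN hM hK => ?_, fun hF hFm N M hN hM => ?_⟩
  · have hF' : ∀ f ∈ F, f ∈ LipBdd Lf |Mf| Set.univ := fun f hf =>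
      LipBdd_mono le_rfl (le_abs_self _) (hF hf)
    obtain ⟨H₁, hH₁m, hH₁, hH₁i⟩ := hS₁ p₁ M hM hp₁ hd₁
    obtain ⟨H₂, hH₂m, hH₂, hH₂i⟩ := hS₀ p₀ N hN hp₀ hd₀
    obtain ⟨H₃, hH₃m, hH₃, hH₃i⟩ := hG p₀ N hN hp₀ hd₀
    have hae : ∀ᵐ s ∂((dataLaw p₀ p₁ N M).prod (noiseLaw D N K)), ∀ i, s.1.1 i ∈ p₀.support :=
      Measure.quasiMeasurePreserving_fst.ae
        (ae_dataLaw_mem_support (p₀ := p₀) (p₁ := p₁) |>.mono fun _ h => h.1)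
    have hK0 : (K : ℝ) ≠ 0 := by exact_mod_cast hK.ne'
    refine ⟨?_, ?_⟩
    -- `ξ` may be wild off the support, so the measurable version uses its continuous extension; the
    -- two agree when all `x i` lie in the support.
    · refine ⟨fun s => ⨆ f ∈ F, ⨆ ξ ∈ Ξ, ENNReal.ofReal
        |loss ε p₀ p₁ f ξ - empLoss ε s.1.1 s.1.2 s.2 f (ext₀ ξ)|, ?_, ?_⟩
      · refine measurable_biSup_ofReal_abs_sub fun f hf ξ hξ => ?_
        have c1 := (mem_LipBdd_univ.1 (hF' f hf)).1.continuous
        have c2 := (mem_LipBdd_univ.1 (hξB ξ hξ)).1.continuous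
        unfold empLoss
        fun_prop
      · filter_upwards [hae] with s hs
        refine biSup_congr fun f _ => biSup_congr fun ξ hξ => ?_
        have : ∀ i, ξ (s.1.1 i) = ext₀ ξ (s.1.1 i) := fun i => (hξext ξ hξ).2 (hs i)
        simp only [empLoss, this]
    · have hb : ∀ f ∈ F, (fun x => Real.exp (ε⁻¹ * f x)) ∈ LipBdd L B Set.univ := fun f hf =>
        LipBdd_mono hL4 (by linarith) (exp_comp_mem_LipBdd (const_mul_mem_LipBdd (hF' f hf) ε⁻¹))
      have hdom : ∀ᵐ s ∂((dataLaw p₀ p₁ N M).prod (noiseLaw D N K)),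
          supDev ε p₀ p₁ F Ξ N M K s ≤ H₁ s.1.2 + ENNReal.ofReal ε * H₂ s.1.1 +
            ENNReal.ofReal ε * (ENNReal.ofReal (1 / (K : ℝ)) *
              ∑ k, H₃ fun i => (s.1.1 i, s.2 i k)) := by
        filter_upwards [hae] with s hs
        refine iSup₂_le fun f hf => iSup₂_le fun ξ hξ => ?_
        rw [loss_sub_empLoss hK hε (hF' f hf) (hξext ξ hξ).1 (hξext ξ hξ).2 hs]
        refine (ofReal_abs_sub_sub_le hε.le _ _ _).trans ?_
        gcongr
        · exact hH₁ f (LipBdd_mono hL1 (by linarith) (hF' f hf)) _ one_mem s.1.2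
        · exact hH₂ _ (hξB ξ hξ) _ one_mem s.1.1
        · rw [abs_mul, abs_of_nonneg (by positivity), ENNReal.ofReal_mul (by positivity)]
          gcongr
          refine (ENNReal.ofReal_le_ofReal (Finset.abs_sum_le_sum_abs _ _)).trans ?_
          rw [ENNReal.ofReal_sum_of_nonneg fun k _ => abs_nonneg _]
          exact Finset.sum_le_sum fun k _ =>
            hH₃ _ (ha ξ hξ) _ (hb f hf) fun i => (s.1.1 i, s.2 i k)
      have m1 : MeasurePreserving (fun s : ((Fin N → EuclideanSpace ℝ (Fin D)) ×
          (Fin M → EuclideanSpace ℝ (Fin D))) × (Fin N → Fin K → EuclideanSpace ℝ (Fin D)) =>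
          s.1.2) ((dataLaw p₀ p₁ N M).prod (noiseLaw D N K)) (Measure.pi fun _ => p₁) :=
        MeasurePreserving.comp (μb := dataLaw p₀ p₁ N M) measurePreserving_snd
          measurePreserving_fst
      have m2 : MeasurePreserving (fun s : ((Fin N → EuclideanSpace ℝ (Fin D)) ×
          (Fin M → EuclideanSpace ℝ (Fin D))) × (Fin N → Fin K → EuclideanSpace ℝ (Fin D)) =>
          s.1.1) ((dataLaw p₀ p₁ N M).prod (noiseLaw D N K)) (Measure.pi fun _ => p₀) :=
        MeasurePreserving.comp (μb := dataLaw p₀ p₁ N M) measurePreserving_fst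
          measurePreserving_fst
      have m3 := fun k : Fin K => measurePreserving_data_noise (N := N) (M := M) (p₀ := p₀)
        (p₁ := p₁) k
      have g3 : ∀ k : Fin K, Measurable fun s : ((Fin N → EuclideanSpace ℝ (Fin D)) ×
          (Fin M → EuclideanSpace ℝ (Fin D))) × (Fin N → Fin K → EuclideanSpace ℝ (Fin D)) =>
          H₃ fun i => (s.1.1 i, s.2 i k) := fun k => hH₃m.comp (m3 k).measurable
      -- Only the marginal law for each fixed `k` matters, so the mean over `k` obeys the same
      -- bound.
      have i3 : ∀ k : Fin K, ∫⁻ s, H₃ (fun i => (s.1.1 i, s.2 i k))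
          ∂((dataLaw p₀ p₁ N M).prod (noiseLaw D N K)) ≤
          ENNReal.ofReal (CG * (N : ℝ) ^ (-(1 / (1 + (D : ℝ))))) := fun k =>
        ((m3 k).lintegral_comp hH₃m).trans_le hH₃i
      refine (lintegral_mono_ae hdom).trans ?_
      rw [lintegral_add_const_mul_add_const_mul
          (S := ((Fin N → EuclideanSpace ℝ (Fin D)) × (Fin M → EuclideanSpace ℝ (Fin D))) ×
            (Fin N → Fin K → EuclideanSpace ℝ (Fin D))) (f := fun s => H₁ s.1.2) (g := fun s => H₂ s.1.1)
          (h := fun s => ENNReal.ofReal (1 / (K : ℝ)) * ∑ k, H₃ fun i => (s.1.1 i, s.2 i k))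
          (hH₁m.comp m1.measurable) (hH₂m.comp m2.measurable)
          ((Finset.measurable_sum _ fun k _ => g3 k).const_mul _),
        lintegral_const_mul _ (Finset.measurable_sum _ fun k _ => g3 k),
        lintegral_finsetSum _ fun k _ => g3 k,
        m1.lintegral_comp hH₁m, m2.lintegral_comp hH₂m]
      refine (add_le_add (add_le_add hH₁i (mul_le_mul_right hH₂i _))
        (mul_le_mul_right (mul_le_mul_right (Finset.sum_le_sum fun k _ => i3 k) _) _)).trans ?_
      rw [← ENNReal.ofReal_sum_of_nonneg fun k _ => by positivity,
        ← ENNReal.ofReal_mul hε.le, ← ENNReal.ofReal_mul (by positivity),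
        ← ENNReal.ofReal_mul hε.le, ← ENNReal.ofReal_add (by positivity) (by positivity),
        ← ENNReal.ofReal_add (by positivity)
          (mul_nonneg hε.le (mul_nonneg (by positivity) (Finset.sum_nonneg fun k _ => by
            positivity)))]
      refine ENNReal.ofReal_le_ofReal ?_
      have hpos : 0 ≤ ε * CS₀ * (N : ℝ) ^ (-(1 / (1 + (D : ℝ)))) := by positivity
      rw [Finset.sum_const, Finset.card_univ, Fintype.card_fin, nsmul_eq_mul, ← mul_assoc (1 / _),
        one_div_mul_cancel hK0]
      linarith
  · obtain ⟨ext₁, hext₁⟩ := exists_extension_map hMf Lf p₁.support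
    have hfext : ∀ f ∈ F, ext₁ f ∈ LipBdd Lf |Mf| Set.univ ∧ Set.EqOn f (ext₁ f) p₁.support :=
      fun f hf => hext₁ f (LipBdd_mono le_rfl (le_abs_self _) (hF hf))
    have hg : ∀ f ∈ F, gaussSmooth ε f ∈ LipBdd L B Set.univ := fun f hf =>
      LipBdd_mono hL5 (by linarith)
        (hLg f (hFm f hf).1 fun x => ((hFm f hf).2 x).trans (le_abs_self _))
    obtain ⟨H₁, hH₁m, hH₁, hH₁i⟩ := hS₁ p₁ M hM hp₁ hd₁
    obtain ⟨H₂, hH₂m, hH₂, hH₂i⟩ := hS₀ p₀ N hN hp₀ hd₀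
    have hae := ae_dataLaw_mem_support (p₀ := p₀) (p₁ := p₁) (N := N) (M := M)
    refine ⟨?_, ?_⟩
    -- Here `f` is replaced by its extension at the data `y j`, while `gaussSmooth ε f` is
    -- continuous for the original `f`.
    · refine ⟨fun s => ⨆ f ∈ F, ⨆ ξ ∈ Ξ, ENNReal.ofReal
        |(loss ε p₀ p₁ f ξ - lossConst D ε) - (1 / (M : ℝ) * ∑ j, ext₁ f (s.2 j) -
          ε * (1 / (N : ℝ) * ∑ i, ext₀ ξ (s.1 i)) - ε / (N : ℝ) *
            ∑ i, Real.exp (-1 * ext₀ ξ (s.1 i)) * gaussSmooth ε f (s.1 i))|, ?_, ?_⟩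
      · refine measurable_biSup_ofReal_abs_sub (c := fun f ξ => loss ε p₀ p₁ f ξ - lossConst D ε)
          (φ := fun f ξ (s : (Fin N → EuclideanSpace ℝ (Fin D)) ×
            (Fin M → EuclideanSpace ℝ (Fin D))) => 1 / (M : ℝ) * ∑ j, ext₁ f (s.2 j) -
          ε * (1 / (N : ℝ) * ∑ i, ext₀ ξ (s.1 i)) - ε / (N : ℝ) *
            ∑ i, Real.exp (-1 * ext₀ ξ (s.1 i)) * gaussSmooth ε f (s.1 i)) fun f hf ξ hξ => ?_
        have c1 := (mem_LipBdd_univ.1 (hfext f hf).1).1.continuous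
        have c2 := (mem_LipBdd_univ.1 (hξB ξ hξ)).1.continuous
        have c3 := (mem_LipBdd_univ.1 (hg f hf)).1.continuous
        fun_prop
      · filter_upwards [hae] with s hs
        refine biSup_congr fun f hf => biSup_congr fun ξ hξ => ?_
        have h1 : ∀ i, ξ (s.1 i) = ext₀ ξ (s.1 i) := fun i => (hξext ξ hξ).2 (hs.1 i)
        have h2 : ∀ j, f (s.2 j) = ext₁ f (s.2 j) := fun j => (hfext f hf).2 (hs.2 j)
        simp only [empLossExact, expTerm_eq, h1, h2, neg_one_mul]
        congr 2
        ring
    · have hdom : ∀ᵐ s ∂(dataLaw p₀ p₁ N M), supDevExact ε p₀ p₁ F Ξ N M s ≤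
          H₁ s.2 + ENNReal.ofReal ε * H₂ s.1 + ENNReal.ofReal ε * H₂ s.1 := by
        filter_upwards [hae] with s hs
        refine iSup₂_le fun f hf => iSup₂_le fun ξ hξ => ?_
        rw [loss_sub_empLossExact (hfext f hf).2 (hξext ξ hξ).2 hs.1 hs.2]
        refine (ofReal_abs_sub_sub_le hε.le _ _ _).trans ?_
        gcongr
        · exact hH₁ _ (LipBdd_mono hL1 (by linarith) (hfext f hf).1) _ one_mem s.2
        · exact hH₂ _ (hξB ξ hξ) _ one_mem s.1
        -- Both factors are Lipschitz functions of `x` alone, so the envelope of the `ξ`-term serves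
        -- again.
        · exact hH₂ _ (ha ξ hξ) _ (hg f hf) s.1
      have m1 : MeasurePreserving Prod.snd (dataLaw p₀ p₁ N M) (Measure.pi fun _ => p₁) :=
        measurePreserving_snd
      have m2 : MeasurePreserving Prod.fst (dataLaw p₀ p₁ N M) (Measure.pi fun _ => p₀) :=
        measurePreserving_fst
      refine (lintegral_mono_ae hdom).trans ?_
      rw [lintegral_add_const_mul_add_const_mul
          (S := (Fin N → EuclideanSpace ℝ (Fin D)) × (Fin M → EuclideanSpace ℝ (Fin D)))
          (f := fun s => H₁ s.2) (g := fun s => H₂ s.1)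
          (h := fun s => H₂ s.1) (hH₁m.comp m1.measurable) (hH₂m.comp m2.measurable)
          (hH₂m.comp m2.measurable),
        m1.lintegral_comp hH₁m, m2.lintegral_comp hH₂m]
      refine (add_le_add (add_le_add hH₁i (mul_le_mul_right hH₂i _))
        (mul_le_mul_right hH₂i _)).trans ?_
      rw [← ENNReal.ofReal_mul hε.le, ← ENNReal.ofReal_add (by positivity) (by positivity),
        ← ENNReal.ofReal_add (by positivity) (by positivity)]
      refine ENNReal.ofReal_le_ofReal ?_
      have hpos : 0 ≤ ε * CG * (N : ℝ) ^ (-(1 / (1 + (D : ℝ)))) := by positivity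
      linarith
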